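/- Let $\Omega\subset\mathbb{R}^d$ be a smooth bounded domain and let $m>0$. For $1<p<\infty$, a time step $\tau>0$, a number of steps $N\in\mathbb{N}$ and data $F^1,\dots,F^N\in L^p(\Omega)$ (real valued), let $\Psi^0,\dots,\Psi^{N}$ be the solution in $L^p(\Omega)$ of the backward implicit scheme $$\frac{\Psi^{k+1}-\Psi^k}{\tau}+m\Delta\Psi^k=F^{k+1}\ \text{ in }\Omega,\qquad \partial_n\Psi^k=0\ \text{ on }\partial\Omega\qquad(0\le k\le N-1),\qquad \Psi^N=0 .$$ Here $\Delta\Psi=h$ with $\partial_n\Psi=0$, for $\Psi,h\in L^p(\Omega)$, is understood in the sense of transposition: $\int_\Omega\Psi\,\Delta\varphi=\int_\Omega h\,\varphi$ for all $\varphi\in H^1(\Omega)\cap L^\infty(\Omega)$ with $\Delta\varphi\in L^\infty(\Omega)$ and $\partial_n\varphi=0$ in the variational sense $\int_\Omega\nabla\varphi\cdot\nabla\eta=-\int_\Omega\Delta\varphi\,\eta$ for all $\eta\in H^1(\Omega)$ (on a smooth bounded domain this means $\Psi\in W^{2,p}(\Omega)$ with vanishing normal derivative). Let $K_{m,p}\in[0,\infty]$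 be the best constant in $$\Bigl(\sum_{k=0}^{N-1}\tau\|\Delta\Psi^k\|_{L^p(\Omega)}^p\Bigr)^{1/p}\le K_{m,p}\Bigl(\sum_{k=0}^{N-1}\tau\|F^{k+1}\|_{L^p(\Omega)}^p\Bigr)^{1/p},$$ that is, the smallest constant for which this holds for all $\tau>0$, all $N$ and all $F^1,\dots,F^N\in L^p(\Omega)$. Then: 1. If $1<p<\infty$ and $\frac1p+\frac1{p'}=1$, then $K_{m,p}=K_{m,p'}$. 2. If $1<p,q<\infty$, $0<\theta<1$ and $\frac1r=\frac\theta p+\frac{1-\theta}q$, then $K_{m,r}\le K_{m,p}^{\theta}\,K_{m,q}^{1-\theta}$. -/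

import Mathlib

open MeasureTheory
open scoped ENNReal

namespace DiscreteDuality

/-- The Euclidean space `ℝᵈ`. -/
abbrev E (d : ℕ) : Type := EuclideanSpace ℝ (Fin d)

/-- A smooth bounded domain of `ℝᵈ`: a nonempty, bounded, connected open set which near each of its
boundary points is the negativity set of a smooth function with nonzero differential
(so that it lies locally on one side of a smooth hypersurface). -/
structure IsSmoothBoundedDomain {d : ℕ} (Ω : Set (E d)) : Prop where
  isOpen : IsOpen Ω
  isConnected : IsConnected Ω
  isBounded : Bornology.IsBounded Ω
  smooth_boundary : ∀ x ∈ frontier Ω, ∃ (U : Set (E d)) (ρ : E d → ℝ),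
    IsOpen U ∧ x ∈ U ∧ ContDiffOn ℝ (⊤ : ℕ∞) ρ U ∧ fderiv ℝ ρ x ≠ 0 ∧
      Ω ∩ U = {y ∈ U | ρ y < 0}

/-- `u ∈ H¹(Ω)` with weak gradient `v`: both are square integrable on `Ω`, and
`∫_Ω u ∂_e ζ = - ∫_Ω ζ (v · e)` for all `ζ ∈ C_c^∞(Ω)` and all directions `e`. -/
structure IsH1 {d : ℕ} (Ω : Set (E d)) (u : E d → ℝ) (v : E d → E d) : Prop where
  memLp : MemLp u 2 (volume.restrict Ω)
  memLp_grad : MemLp v 2 (volume.restrict Ω)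
  weak_grad : ∀ ζ : E d → ℝ, ContDiff ℝ (⊤ : ℕ∞) ζ → HasCompactSupport ζ → tsupport ζ ⊆ Ω →
    ∀ e : E d, ∫ x in Ω, u x * fderiv ℝ ζ x e = - ∫ x in Ω, ζ x * inner ℝ (v x) e

/-- `φ ∈ H¹(Ω)` is a variational solution of `Δφ = g` in `Ω`, `∂ₙφ = 0` on `∂Ω`, with
`g ∈ L²(Ω)`: one has `∫_Ω ∇φ · ∇η = - ∫_Ω g η` for all `η ∈ H¹(Ω)`. -/
def IsVariationalNeumann {d : ℕ} (Ω : Set (E d)) (φ g : E d → ℝ) : Prop :=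
  MemLp g 2 (volume.restrict Ω) ∧ ∃ v : E d → E d, IsH1 Ω φ v ∧
    ∀ (η : E d → ℝ) (w : E d → E d), IsH1 Ω η w →
      ∫ x in Ω, inner ℝ (v x) (w x) = - ∫ x in Ω, g x * η x

/-- The Neumann Laplacian in `L^p(Ω)`: `ψ, h ∈ L^p(Ω)` satisfy `Δψ = h` in `Ω`, `∂ₙψ = 0` on `∂Ω`,
in the sense of transposition, i.e. `∫_Ω ψ Δφ = ∫_Ω h φ` for all bounded `φ ∈ H¹(Ω)`
with `∂ₙφ = 0` and bounded Laplacian `Δφ = g`. On a smooth bounded domain and for `1 < p < ∞`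
this means that `ψ ∈ W^{2,p}(Ω)`, `Δψ = h` almost everywhere and `∂ₙψ = 0` in the sense of traces. -/
structure HasNeumannLaplacian {d : ℕ} (Ω : Set (E d)) (p : ℝ) (ψ h : E d → ℝ) : Prop where
  memLp : MemLp ψ (ENNReal.ofReal p) (volume.restrict Ω)
  memLp_laplacian : MemLp h (ENNReal.ofReal p) (volume.restrict Ω)
  transposition : ∀ φ g : E d → ℝ, IsVariationalNeumann Ω φ g →
    MemLp φ ⊤ (volume.restrict Ω) → MemLp g ⊤ (volume.restrict Ω) →
      ∫ x in Ω, ψ x * g x = ∫ x in Ω, h x * φ x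

/-- `Ψ⁰, …, Ψᴺ` solves the backward implicit scheme
`(Ψᵏ⁺¹ - Ψᵏ) / τ + m Δ Ψᵏ = Fᵏ⁺¹` in `Ω`, `∂ₙΨᵏ = 0` on `∂Ω` (`0 ≤ k < N`), `Ψᴺ = 0`,
where `H k` denotes `Δ Ψᵏ`. -/
structure IsSchemeSolution {d : ℕ} (Ω : Set (E d)) (m p τ : ℝ) (N : ℕ)
    (F Ψ H : ℕ → E d → ℝ) : Prop where
  final : ∀ᵐ x ∂(volume.restrict Ω), Ψ N x = 0
  neumann : ∀ k < N, HasNeumannLaplacian Ω p (Ψ k) (H k)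
  equation : ∀ k < N, ∀ᵐ x ∂(volume.restrict Ω),
    (Ψ (k + 1) x - Ψ k x) / τ + m * H k x = F (k + 1) x

/-- The discrete norm `(∑_{0 ≤ k < N} τ ‖uᵏ‖_{L^p(Ω)}^p)^{1/p}`. -/
noncomputable def discreteNorm {d : ℕ} (Ω : Set (E d)) (p τ : ℝ) (N : ℕ)
    (u : ℕ → E d → ℝ) : ℝ≥0∞ :=
  (∑ k ∈ Finset.range N, ENNReal.ofReal τ *
    eLpNorm (u k) (ENNReal.ofReal p) (volume.restrict Ω) ^ p) ^ (1 / p)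

/-- `C` is an admissible constant: `‖(ΔΨᵏ)_{0 ≤ k < N}‖ ≤ C ‖(Fᵏ⁺¹)_{0 ≤ k < N}‖` for every time
step `τ > 0`, every number of steps `N`, all data `F¹, …, Fᴺ ∈ L^p(Ω)` and the corresponding
solution of the scheme. -/
def IsAdmissible {d : ℕ} (Ω : Set (E d)) (m p : ℝ) (C : ℝ≥0∞) : Prop :=
  ∀ (τ : ℝ) (N : ℕ), 0 < τ → ∀ F Ψ H : ℕ → E d → ℝ,
    (∀ k < N, MemLp (F (k + 1)) (ENNReal.ofReal p) (volume.restrict Ω)) →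
    IsSchemeSolution Ω m p τ N F Ψ H →
      discreteNorm Ω p τ N H ≤ C * discreteNorm Ω p τ N (fun k => F (k + 1))

/-- The best constant `K_{m,p} ∈ [0, ∞]`. -/
noncomputable def K {d : ℕ} (Ω : Set (E d)) (m p : ℝ) : ℝ≥0∞ :=
  sInf {C : ℝ≥0∞ | IsAdmissible Ω m p C}

end DiscreteDuality

namespace DiscreteDuality

/-! ### The converse of Hölder's inequality in `Lᵖ` -/

section Duality

variable {X : Type*} [MeasurableSpace X] {μ : Measure X}

/-! The discrete norms are `Lᵖ` norms for the measure `spaceTime`, and the scheme defines a linear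
map from data to Laplacians. Both claims are facts about this map.

Duality: pairing one solution with the time reversal of another and summing by parts shows that the
transpose of the map is the map itself conjugated by `k ↦ N - 1 - k`
(`IsSchemeSolution.sum_integral_eq`). Time reversal preserves the norms, so by the converse of
Hölder's inequality a constant valid for `p` is valid for `p'`.

Interpolation: this is Riesz-Thorin on the diagonal. The functions are real and the constant must
not deteriorate, so real bounds are first extended to complex coefficients without loss
(`eLpNorm_complex_le`), and then the three lines theorem is applied (`riesz_thorin_simpleFunc`).

No `Lᵖ` elliptic regularity or solvability is needed. Only bounded data are ever solved for:
existence comes from a Hilbert space projection, boundedness from a maximum principle that rests on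
the chain rule in `H¹`. These bounded solutions serve as test functions for arbitrary `Lᵖ`
solutions. Dualising twice shows that a constant valid for simple data is valid for all data
(`isAdmissible_iff_isSimpleAdmissible`), so interpolation can be done on simple data alone. -/

theorem eLpNorm_ofReal_eq {F : Type*} [NormedAddCommGroup F] {p : ℝ} (hp : 0 < p) (f : X → F) :
    eLpNorm f (ENNReal.ofReal p) μ = (∫⁻ x, ‖f x‖ₑ ^ p ∂μ) ^ (1 / p) := by
  rw [eLpNorm_eq_lintegral_rpow_enorm_toReal (by simpa using hp) ENNReal.ofReal_ne_top,
    ENNReal.toReal_ofReal hp.le]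

theorem lintegral_enorm_rpow_eq {F : Type*} [NormedAddCommGroup F] {p : ℝ} (hp : 0 < p)
    (f : X → F) :
    ∫⁻ x, ‖f x‖ₑ ^ p ∂μ = eLpNorm f (ENNReal.ofReal p) μ ^ p := by
  rw [eLpNorm_ofReal_eq hp, ← ENNReal.rpow_mul, one_div_mul_cancel hp.ne', ENNReal.rpow_one]

theorem lintegral_enorm_mul_le {𝕜 : Type*} [NormedField 𝕜] {p q : ℝ} (hpq : p.HolderConjugate q)
    {f g : X → 𝕜} (hf : AEStronglyMeasurable f μ) (hg : AEStronglyMeasurable g μ) :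
    ∫⁻ x, ‖f x * g x‖ₑ ∂μ ≤
      eLpNorm f (ENNReal.ofReal p) μ * eLpNorm g (ENNReal.ofReal q) μ := by
  rw [eLpNorm_ofReal_eq hpq.pos, eLpNorm_ofReal_eq hpq.symm.pos]
  simp only [enorm_mul]
  exact ENNReal.lintegral_mul_le_Lp_mul_Lq μ hpq hf.enorm hg.enorm

theorem ofReal_integral_le_lintegral_enorm (f : X → ℝ) :
    ENNReal.ofReal (∫ x, f x ∂μ) ≤ ∫⁻ x, ‖f x‖ₑ ∂μ :=
  (ENNReal.ofReal_le_ofReal (le_abs_self _)).trans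
    ((Real.enorm_eq_ofReal_abs _).symm.le.trans (enorm_integral_le_lintegral_enorm f))

theorem MemLp.integrable_mul_of_holderConjugate {p q : ℝ} (hpq : p.HolderConjugate q)
    {f g : X → ℝ} (hf : MemLp f (ENNReal.ofReal p) μ) (hg : MemLp g (ENNReal.ofReal q) μ) :
    Integrable (fun x => f x * g x) μ :=
  ⟨hf.1.mul hg.1, (lintegral_enorm_mul_le hpq hf.1 hg.1).trans_lt
    (ENNReal.mul_lt_top hf.2 hg.2)⟩

/-- Simple functions are dense in `Lᵖ` and `h` pairs continuously with `Lᵖ`. The error is a finite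
multiple of `ε`, which is where `M ≠ ⊤` enters. -/
theorem ofReal_integral_mul_le_of_simpleFunc [IsFiniteMeasure μ] {p q : ℝ}
    (hpq : p.HolderConjugate q) {h : X → ℝ} (hh : MemLp h (ENNReal.ofReal q) μ) {M : ℝ≥0∞}
    (hM : M ≠ ⊤) (H : ∀ g : SimpleFunc X ℝ,
      ENNReal.ofReal (∫ x, h x * g x ∂μ) ≤ M * eLpNorm g (ENNReal.ofReal p) μ)
    {G : X → ℝ} (hG : MemLp G (ENNReal.ofReal p) μ) :
    ENNReal.ofReal (∫ x, h x * G x ∂μ) ≤ M * eLpNorm G (ENNReal.ofReal p) μ := by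
  have key : ∀ ε : ℝ≥0∞, ε ≠ 0 → ENNReal.ofReal (∫ x, h x * G x ∂μ) ≤
      M * eLpNorm G (ENNReal.ofReal p) μ + (M + eLpNorm h (ENNReal.ofReal q) μ) * ε := by
    intro ε hε
    obtain ⟨s, hs, hsm⟩ := hG.exists_simpleFunc_eLpNorm_sub_lt ENNReal.ofReal_ne_top hε
    have hsub : MemLp (G - ⇑s) (ENNReal.ofReal p) μ := hG.sub hsm
    have e1 : ∫ x, h x * G x ∂μ = (∫ x, h x * s x ∂μ) + ∫ x, h x * (G - ⇑s) x ∂μ := by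
      rw [← integral_add (MemLp.integrable_mul_of_holderConjugate hpq.symm hh hsm)
        (MemLp.integrable_mul_of_holderConjugate hpq.symm hh hsub)]
      congr 1; ext x; simp only [Pi.sub_apply]; ring
    have e2 : eLpNorm s (ENNReal.ofReal p) μ ≤ eLpNorm G (ENNReal.ofReal p) μ + ε := by
      have : (s : X → ℝ) = G - (G - ⇑s) := by simp
      rw [this]
      refine (eLpNorm_sub_le hG.1 hsub.1 ?_).trans (add_le_add le_rfl hs.le)
      simpa using hpq.lt.le
    calc ENNReal.ofReal (∫ x, h x * G x ∂μ)
        ≤ ENNReal.ofReal (∫ x, h x * s x ∂μ) + ENNReal.ofReal (∫ x, h x * (G - ⇑s) x ∂μ) := by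
          rw [e1]; exact ENNReal.ofReal_add_le
      _ ≤ M * (eLpNorm G (ENNReal.ofReal p) μ + ε) + eLpNorm h (ENNReal.ofReal q) μ * ε := by
          refine add_le_add ((H s).trans (by gcongr)) ?_
          refine (ofReal_integral_le_lintegral_enorm _).trans
            ((lintegral_enorm_mul_le hpq.symm hh.1 hsub.1).trans ?_)
          gcongr
      _ = _ := by ring
  have hc : M + eLpNorm h (ENNReal.ofReal q) μ ≠ ⊤ := ENNReal.add_ne_top.2 ⟨hM, hh.2.ne⟩
  have ht : Filter.Tendsto (fun n : ℕ => M * eLpNorm G (ENNReal.ofReal p) μ +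
      (M + eLpNorm h (ENNReal.ofReal q) μ) * ((n : ℝ≥0∞)⁻¹)) Filter.atTop
      (nhds (M * eLpNorm G (ENNReal.ofReal p) μ +
      (M + eLpNorm h (ENNReal.ofReal q) μ) * 0)) :=
    tendsto_const_nhds.add
      (ENNReal.Tendsto.const_mul ENNReal.tendsto_inv_nat_nhds_zero (Or.inr hc))
  rw [mul_zero, add_zero] at ht
  exact ge_of_tendsto' ht fun n => key _ (by simp)

/-- Converse of Hölder's inequality, tested on simple functions. -/
theorem eLpNorm_le_of_simpleFunc [IsFiniteMeasure μ] {p q : ℝ}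
    (hpq : p.HolderConjugate q) {h : X → ℝ} (hh : MemLp h (ENNReal.ofReal q) μ) {M : ℝ≥0∞}
    (H : ∀ g : SimpleFunc X ℝ,
      ENNReal.ofReal (∫ x, h x * g x ∂μ) ≤ M * eLpNorm g (ENNReal.ofReal p) μ) :
    eLpNorm h (ENNReal.ofReal q) μ ≤ M := by
  rcases eq_or_ne M ⊤ with rfl | hM
  · exact le_top
  have hp0 := hpq.pos
  have hq0 := hpq.symm.pos
  have hq1 : 0 < q - 1 := by linarith [hpq.symm.lt]
  -- The extremal of Hölder's inequality: `|G|^p = |h|^q` because `(q - 1) p = q`, and `h G =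
  -- |h|^q`.
  set G : X → ℝ := fun x => SignType.sign (h x) * |h x| ^ (q - 1) with hGdef
  have hnorm : ∀ x, ‖G x‖ₑ ^ p = ‖h x‖ₑ ^ q := by
    intro x
    have h1 : |G x| = |h x| ^ (q - 1) := by
      simp only [hGdef, abs_mul]
      rcases eq_or_ne (h x) 0 with h0 | h0
      · simp [h0, Real.zero_rpow hq1.ne']
      · rcases lt_or_gt_of_ne h0 with h2 | h2 <;>
          simp [h2, abs_of_nonneg (Real.rpow_nonneg (abs_nonneg (h x)) (q - 1))]
    rw [Real.enorm_eq_ofReal_abs, Real.enorm_eq_ofReal_abs, h1,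
      ENNReal.ofReal_rpow_of_nonneg (Real.rpow_nonneg (abs_nonneg _) _) hp0.le,
      ENNReal.ofReal_rpow_of_nonneg (abs_nonneg _) hq0.le, ← Real.rpow_mul (abs_nonneg _)]
    congr 2
    have := hpq.mul_eq_add
    linarith
  have hmul : ∀ x, h x * G x = |h x| ^ q := by
    intro x
    have h1 : h x * SignType.sign (h x) = |h x| := by rw [self_mul_sign]
    simp only [hGdef]
    rw [← mul_assoc, h1]
    rcases eq_or_ne (h x) 0 with h0 | h0
    · simp [h0, Real.zero_rpow hq0.ne']
    · rw [← Real.rpow_one_add' (abs_nonneg _) (by linarith)]; congr 1; ring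
  have hGm : AEStronglyMeasurable G μ := by
    have hm : AEMeasurable h μ := hh.1.aemeasurable
    have m1 : Measurable fun t : ℝ => ((SignType.sign t : SignType) : ℝ) := by
      have : (fun t : ℝ => ((SignType.sign t : SignType) : ℝ)) =
          fun t => if 0 < t then 1 else if t < 0 then -1 else 0 := by
        ext t
        rw [sign_apply]
        split_ifs <;> simp
      rw [this]
      exact Measurable.ite measurableSet_Ioi measurable_const
        (Measurable.ite measurableSet_Iio measurable_const measurable_const)
    have m2 : Measurable fun t : ℝ => |t| ^ (q - 1) :=
      (by fun_prop : Measurable fun t : ℝ => |t|).pow_const _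
    exact ((m1.mul m2).comp_aemeasurable hm).aestronglyMeasurable
  have hGI : eLpNorm G (ENNReal.ofReal p) μ = (∫⁻ x, ‖h x‖ₑ ^ q ∂μ) ^ (1 / p) := by
    rw [eLpNorm_ofReal_eq hp0]; simp only [hnorm]
  have hI : ∫⁻ x, ‖h x‖ₑ ^ q ∂μ ≠ ⊤ := by
    rw [lintegral_enorm_rpow_eq hq0]
    exact ENNReal.rpow_ne_top_of_nonneg hq0.le hh.2.ne
  have hG : MemLp G (ENNReal.ofReal p) μ :=
    ⟨hGm, by rw [hGI]; exact (ENNReal.rpow_ne_top_of_nonneg (by positivity) hI).lt_top⟩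
  have key := ofReal_integral_mul_le_of_simpleFunc hpq hh hM H hG
  have hint : ENNReal.ofReal (∫ x, h x * G x ∂μ) = ∫⁻ x, ‖h x‖ₑ ^ q ∂μ := by
    rw [ofReal_integral_eq_lintegral_ofReal
      (MemLp.integrable_mul_of_holderConjugate hpq.symm hh hG)]
    · refine lintegral_congr fun x => ?_
      rw [hmul, Real.enorm_eq_ofReal_abs, ENNReal.ofReal_rpow_of_nonneg (abs_nonneg _) hq0.le]
    · exact Filter.Eventually.of_forall fun x => by
        simp only [hmul]; positivity
  rw [hint, hGI] at key
  rw [eLpNorm_ofReal_eq hq0]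
  set I := ∫⁻ x, ‖h x‖ₑ ^ q ∂μ
  rcases eq_or_ne I 0 with h0 | h0
  · simp [h0, hq0]
  have hsplit : I = I ^ (1 / q) * I ^ (1 / p) := by
    rw [← ENNReal.rpow_add _ _ h0 hI]
    have := hpq.symm.inv_add_inv_eq_one
    rw [one_div, one_div, this, ENNReal.rpow_one]
  have hne0 : I ^ (1 / p) ≠ 0 := by
    simp [h0, hI]
  have hnet : I ^ (1 / p) ≠ ⊤ := ENNReal.rpow_ne_top_of_nonneg (by positivity) hI
  rw [hsplit] at key
  have : (I ^ (1 / q) * I ^ (1 / p)) ^ (1 / p) = I ^ (1 / p) := by rw [← hsplit]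
  rw [this] at key
  exact (ENNReal.mul_le_mul_iff_left hne0 hnet).1 key

end Duality

/-! ### From real to complex coefficients without loss in the constant -/

section Complexification

variable {X : Type*} [MeasurableSpace X] {μ : Measure X}

/-- Write `z = |z| c` with `|c| = 1`: then `Re (w z) = |z| Re (c w)`, and Lebesgue measure on the
disc is invariant under rotation by `c`. Averaging real parts over `w` thus recovers `|z|^p` up to a
factor independent of `z`. -/
theorem lintegral_ball_enorm_re_mul (p : ℝ) (hp : 0 ≤ p) (z : ℂ) :
    ∫⁻ w in Metric.ball (0 : ℂ) 1, ‖(w * z).re‖ₑ ^ p =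
      (∫⁻ w in Metric.ball (0 : ℂ) 1, ‖w.re‖ₑ ^ p) * ‖z‖ₑ ^ p := by
  obtain ⟨c, hc⟩ : ∃ c : Circle, z = (‖z‖ : ℂ) * c := by
    refine ⟨Circle.exp z.arg, ?_⟩
    rw [Circle.coe_exp]
    exact (Complex.norm_mul_exp_arg_mul_I z).symm
  have h1 : ∀ w : ℂ, ‖(w * z).re‖ₑ ^ p = ‖(rotation c w).re‖ₑ ^ p * ‖z‖ₑ ^ p := by
    intro w
    have : w * z = ((‖z‖ : ℝ) : ℂ) * (rotation c w) := by
      conv_lhs => rw [hc]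
      rw [rotation_apply]; ring
    rw [this, Complex.re_ofReal_mul, enorm_mul, enorm_norm, ENNReal.mul_rpow_of_nonneg _ _ hp,
      mul_comm]
  simp only [h1]
  have hm : Measurable fun w : ℂ => ‖w.re‖ₑ ^ p :=
    (Complex.measurable_re.enorm).pow_const _
  rw [lintegral_mul_const _ (by
    exact hm.comp (rotation c).continuous.measurable)]
  congr 1
  have hb : (rotation c) ⁻¹' Metric.ball (0 : ℂ) 1 = Metric.ball (0 : ℂ) 1 := by
    ext w; rw [Set.mem_preimage, mem_ball_zero_iff, mem_ball_zero_iff, LinearIsometryEquiv.norm_map]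
  have := (rotation c).measurePreserving.setLIntegral_comp_preimage
    (s := Metric.ball (0 : ℂ) 1) Metric.isOpen_ball.measurableSet hm
  rw [hb] at this
  exact this

theorem lintegral_ball_enorm_re_ne_zero (p : ℝ) :
    ∫⁻ w in Metric.ball (0 : ℂ) 1, ‖w.re‖ₑ ^ p ≠ 0 := by
  have hm : Measurable fun w : ℂ => ‖w.re‖ₑ ^ p :=
    (Complex.measurable_re.enorm).pow_const _
  intro h
  rw [setLIntegral_eq_zero_iff Metric.isOpen_ball.measurableSet hm] at h
  have hU : IsOpen (Metric.ball (0 : ℂ) 1 ∩ {w | 0 < w.re}) :=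
    Metric.isOpen_ball.inter (isOpen_lt continuous_const Complex.continuous_re)
  have hne : (Metric.ball (0 : ℂ) 1 ∩ {w | 0 < w.re}).Nonempty :=
    ⟨(1 / 2 : ℝ), by simp; norm_num, by
      show (0 : ℝ) < ((1 / 2 : ℝ) : ℂ).re
      rw [Complex.ofReal_re]; norm_num⟩
  refine (hU.measure_pos volume hne).ne' (measure_mono_null ?_ (ae_iff.1 h))
  rintro w ⟨hw, hw'⟩ hcon
  have hre : (0 : ℝ) < w.re := hw'
  have hz := hcon hw
  rw [ENNReal.rpow_eq_zero_iff] at hz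
  rcases hz with hz | hz
  · simp [hre.ne'] at hz
  · exact enorm_ne_top hz.1

theorem lintegral_ball_enorm_re_ne_top (p : ℝ) (hp : 0 ≤ p) :
    ∫⁻ w in Metric.ball (0 : ℂ) 1, ‖w.re‖ₑ ^ p ≠ ⊤ := by
  refine ne_top_of_le_ne_top (b := ∫⁻ w in Metric.ball (0 : ℂ) 1, 1) ?_ ?_
  · simp
  · refine setLIntegral_mono measurable_const fun w hw => ?_
    refine ENNReal.rpow_le_one ?_ hp
    have h1 : |w.re| ≤ 1 := (Complex.abs_re_le_norm w).trans (mem_ball_zero_iff.1 hw).le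
    rw [Real.enorm_eq_ofReal_abs]
    exact ENNReal.ofReal_le_one.2 h1

theorem lintegral_lintegral_ball_re [SFinite μ] {p : ℝ} (hp : 0 ≤ p) {F : X → ℂ}
    (hF : AEStronglyMeasurable F μ) :
    ∫⁻ w in Metric.ball (0 : ℂ) 1, ∫⁻ x, ‖(w * F x).re‖ₑ ^ p ∂μ =
      (∫⁻ w in Metric.ball (0 : ℂ) 1, ‖w.re‖ₑ ^ p) * ∫⁻ x, ‖F x‖ₑ ^ p ∂μ := by
  rw [lintegral_lintegral_swap]
  · simp only [lintegral_ball_enorm_re_mul p hp]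
    rw [lintegral_const_mul' _ _ (lintegral_ball_enorm_re_ne_top p hp)]
  · have h1 : AEMeasurable (fun z : ℂ × X => z.1 * F z.2)
        ((volume.restrict (Metric.ball (0 : ℂ) 1)).prod μ) :=
      measurable_fst.aemeasurable.mul hF.aemeasurable.comp_snd
    exact ((Complex.measurable_re.comp_aemeasurable h1).enorm).pow_const _

/-- A real `Lᵖ → Lᵖ` bound passes to complex coefficients with the same constant. -/
theorem eLpNorm_complex_le [SFinite μ] {p : ℝ} (hp : 0 < p) (f : SimpleFunc X ℝ) {ψ : ℝ → X → ℝ}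
    (hψ : ∀ a, AEStronglyMeasurable (ψ a) μ) {C : ℝ≥0∞} (hC : C ≠ ⊤)
    (H : ∀ c : ℝ → ℝ, eLpNorm (fun x => ∑ a ∈ f.range, c a * ψ a x) (ENNReal.ofReal p) μ ≤
      C * eLpNorm (fun x => c (f x)) (ENNReal.ofReal p) μ) (c : ℝ → ℂ) :
    eLpNorm (fun x => ∑ a ∈ f.range, c a * (ψ a x : ℂ)) (ENNReal.ofReal p) μ ≤
      C * eLpNorm (fun x => c (f x)) (ENNReal.ofReal p) μ := by
  set κ := ∫⁻ w in Metric.ball (0 : ℂ) 1, ‖w.re‖ₑ ^ p with hκ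
  have hκ0 : κ ≠ 0 := lintegral_ball_enorm_re_ne_zero p
  have hκt : κ ≠ ⊤ := lintegral_ball_enorm_re_ne_top p hp.le
  have hF : AEStronglyMeasurable (fun x => ∑ a ∈ f.range, c a * (ψ a x : ℂ)) μ := by
    refine Finset.aestronglyMeasurable_fun_sum _ fun a _ => ?_
    exact aestronglyMeasurable_const.mul
      (Complex.continuous_ofReal.comp_aestronglyMeasurable (hψ a))
  have hf : AEStronglyMeasurable (fun x => c (f x)) μ :=
    (f.map c).aestronglyMeasurable
  -- As each `ψ a` is real, `Re (w ∑ c a ψ a) = ∑ Re (w c a) ψ a`. The real bound is used with the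
  -- coefficients `Re (w c a)` and integrated over `w` in the disc; both sides acquire the same
  -- factor `κ`, which cancels.
  have key : κ * ∫⁻ x, ‖∑ a ∈ f.range, c a * (ψ a x : ℂ)‖ₑ ^ p ∂μ ≤
      κ * (C ^ p * ∫⁻ x, ‖c (f x)‖ₑ ^ p ∂μ) := by
    rw [mul_left_comm, ← lintegral_lintegral_ball_re hp.le hF,
      ← lintegral_lintegral_ball_re hp.le hf]
    rw [← lintegral_const_mul' _ _ (ENNReal.rpow_ne_top_of_nonneg hp.le hC)]
    refine lintegral_mono fun w => ?_
    have h1 := ENNReal.rpow_le_rpow (H fun a => (w * c a).re) hp.le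
    rw [ENNReal.mul_rpow_of_nonneg _ _ hp.le, ← lintegral_enorm_rpow_eq hp,
      ← lintegral_enorm_rpow_eq hp] at h1
    refine le_of_eq_of_le (lintegral_congr fun x => ?_) h1
    congr 2
    rw [Finset.mul_sum, Complex.re_sum]
    refine Finset.sum_congr rfl fun a _ => ?_
    rw [← mul_assoc, Complex.re_mul_ofReal]
  rw [ENNReal.mul_le_mul_iff_right hκ0 hκt, lintegral_enorm_rpow_eq hp, lintegral_enorm_rpow_eq hp,
    ← ENNReal.mul_rpow_of_nonneg _ _ hp.le] at key
  exact (ENNReal.rpow_le_rpow_iff hp).1 key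

end Complexification

/-! ### Riesz-Thorin interpolation with equal source and target exponents -/

section RieszThorin

/-- The analytic family `z ↦ sgn(a) |a|^{s (z / p + (1 - z) / q)}`. -/
noncomputable def analyticPower (s p q a : ℝ) (z : ℂ) : ℂ :=
  if a = 0 then 0 else ((SignType.sign a : ℝ) : ℂ) * ((|a| : ℝ) : ℂ) ^ (s * (z / p + (1 - z) / q) : ℂ)

variable {s p q a : ℝ}

/-- The value at `a = 0` is set apart in the definition because `z ↦ b ^ z` is entire only for a
nonzero base. -/
theorem differentiable_analyticPower (s p q a : ℝ) : Differentiable ℂ (analyticPower s p q a) := by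
  unfold analyticPower
  by_cases h : a = 0
  · simp [h]
  · simp only [h, if_false]
    refine Differentiable.const_mul (Differentiable.const_cpow (by fun_prop) (Or.inl ?_)) _
    simpa using h

theorem norm_analyticPower (h : a ≠ 0) (z : ℂ) :
    ‖analyticPower s p q a z‖ = |a| ^ (s * (z.re / p + (1 - z.re) / q)) := by
  have h1 : ‖((SignType.sign a : ℝ) : ℂ)‖ = 1 := by
    rcases lt_or_gt_of_ne h with h2 | h2 <;> simp [h2]
  simp only [analyticPower, h, if_false]
  rw [norm_mul, h1, one_mul, Complex.norm_cpow_eq_rpow_re_of_pos (abs_pos.2 h)]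
  congr 1
  simp [Complex.div_ofReal_re]

/-- A bound independent of `z` in the closed strip, as the three lines theorem demands. The base `1
+ |a| ≥ 1` makes the power monotone in its exponent. -/
theorem norm_analyticPower_le (hs : 0 ≤ s) (hp : 0 < p) (hq : 0 < q) {z : ℂ} (h0 : 0 ≤ z.re)
    (h1 : z.re ≤ 1) : ‖analyticPower s p q a z‖ ≤ (1 + |a|) ^ (s * (1 / p + 1 / q)) := by
  by_cases h : a = 0
  · simp [analyticPower, h]
  · rw [norm_analyticPower h]
    have : 0 ≤ 1 - z.re := by linarith
    calc |a| ^ (s * (z.re / p + (1 - z.re) / q)) ≤ (1 + |a|) ^ (s * (z.re / p + (1 - z.re) / q)) := by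
          gcongr; linarith
      _ ≤ _ := by
          refine Real.rpow_le_rpow_of_exponent_le (by linarith [abs_nonneg a]) ?_
          gcongr; linarith

theorem analyticPower_of_eq_one {t : ℝ} (h : s * (t / p + (1 - t) / q) = 1) :
    analyticPower s p q a t = a := by
  by_cases ha : a = 0
  · simp [analyticPower, ha]
  · simp only [analyticPower, ha, if_false]
    have : (s * ((t : ℂ) / p + (1 - t) / q) : ℂ) = ((1 : ℝ) : ℂ) := by
      rw [← h]; push_cast; ring
    rw [this, Complex.ofReal_one, Complex.cpow_one, ← Complex.ofReal_mul, sign_mul_abs]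

/-- On this vertical line the modulus is `|a|^{s/u}` whatever the imaginary part, so the `Lᵘ` norm
of the family is a fixed power of the `Lˢ` norm of the original function. -/
theorem enorm_analyticPower_of_re_eq {u : ℝ} (hs : 0 < s) (hu : 0 < u) {z : ℂ}
    (h : z.re / p + (1 - z.re) / q = 1 / u) :
    ‖analyticPower s p q a z‖ₑ ^ u = ‖a‖ₑ ^ s := by
  by_cases ha : a = 0
  · simp [analyticPower, ha, hs, hu]
  · rw [← ofReal_norm, norm_analyticPower ha, h, Real.enorm_eq_ofReal_abs,
      ENNReal.ofReal_rpow_of_nonneg (by positivity) hu.le,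
      ENNReal.ofReal_rpow_of_nonneg (by positivity) hs.le, ← Real.rpow_mul (abs_nonneg a)]
    congr 2
    field_simp

variable {X : Type*} [MeasurableSpace X] {μ : Measure X}

theorem eLpNorm_analyticPower {u : ℝ} (hs : 0 < s) (hu : 0 < u) {z : ℂ}
    (h : z.re / p + (1 - z.re) / q = 1 / u) (f : X → ℝ) :
    eLpNorm (fun x => analyticPower s p q (f x) z) (ENNReal.ofReal u) μ =
      eLpNorm f (ENNReal.ofReal s) μ ^ (s / u) := by
  rw [eLpNorm_ofReal_eq hu, eLpNorm_ofReal_eq hs]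
  simp only [enorm_analyticPower_of_re_eq hs hu h]
  rw [← ENNReal.rpow_mul]
  congr 1
  field_simp

theorem simpleFunc_eLpNorm_ne_top [IsFiniteMeasure μ] (f : SimpleFunc X ℝ) (p : ℝ≥0∞) :
    eLpNorm f p μ ≠ ⊤ := (SimpleFunc.memLp_of_isFiniteMeasure f p μ).2.ne

/-- The edge estimate in the Riesz-Thorin argument. -/
theorem norm_integral_analyticPower_le [IsFiniteMeasure μ] {s' p' q' u u' : ℝ}
    (hs : 0 < s) (hs' : 0 < s') (huu : u.HolderConjugate u') {z : ℂ}
    (h : z.re / p + (1 - z.re) / q = 1 / u) (h' : z.re / p' + (1 - z.re) / q' = 1 / u')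
    (f g : SimpleFunc X ℝ) {ψ : ℝ → X → ℝ}
    (hψ : ∀ a, AEStronglyMeasurable (ψ a) μ) {C : ℝ≥0∞} (hC : C ≠ ⊤)
    (H : ∀ c : ℝ → ℝ, eLpNorm (fun x => ∑ a ∈ f.range, c a * ψ a x) (ENNReal.ofReal u) μ ≤
      C * eLpNorm (fun x => c (f x)) (ENNReal.ofReal u) μ) :
    ‖∫ x, (∑ a ∈ f.range, analyticPower s p q a z * (ψ a x : ℂ)) *
      analyticPower s' p' q' (g x) z ∂μ‖ ≤
      C.toReal * (eLpNorm f (ENNReal.ofReal s) μ).toReal ^ (s / u) *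
        (eLpNorm g (ENNReal.ofReal s') μ).toReal ^ (s' / u') := by
  have hF : AEStronglyMeasurable
      (fun x => ∑ a ∈ f.range, analyticPower s p q a z * (ψ a x : ℂ)) μ :=
    Finset.aestronglyMeasurable_fun_sum _ fun a _ => aestronglyMeasurable_const.mul
      (Complex.continuous_ofReal.comp_aestronglyMeasurable (hψ a))
  have hG : AEStronglyMeasurable (fun x => analyticPower s' p' q' (g x) z) μ :=
    (g.map fun b => analyticPower s' p' q' b z).aestronglyMeasurable
  have h1 := (enorm_integral_le_lintegral_enorm _).trans (lintegral_enorm_mul_le huu hF hG)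
  have h2 := h1.trans (mul_le_mul_left (eLpNorm_complex_le huu.pos f hψ hC H _) _)
  rw [eLpNorm_analyticPower hs huu.pos h, eLpNorm_analyticPower hs' huu.symm.pos h'] at h2
  have h3 := ENNReal.toReal_mono ?_ h2
  · simpa [ENNReal.toReal_mul, ENNReal.toReal_rpow] using h3
  · refine ENNReal.mul_ne_top (ENNReal.mul_ne_top hC ?_) ?_
    · exact ENNReal.rpow_ne_top_of_nonneg (div_pos hs huu.pos).le (simpleFunc_eLpNorm_ne_top f _)
    · exact ENNReal.rpow_ne_top_of_nonneg (div_pos hs' huu.symm.pos).le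
        (simpleFunc_eLpNorm_ne_top g _)

/-- Riesz-Thorin interpolation for one simple function, with diagonal exponents. -/
theorem riesz_thorin_simpleFunc [IsFiniteMeasure μ] {p q r p' q' r' θ : ℝ}
    (hpp : p.HolderConjugate p') (hqq : q.HolderConjugate q') (hrr : r.HolderConjugate r')
    (hθ0 : 0 < θ) (hθ1 : θ < 1) (hr : 1 / r = θ / p + (1 - θ) / q)
    (f : SimpleFunc X ℝ) {ψ : ℝ → X → ℝ}
    (hψ : ∀ a, MemLp (ψ a) ⊤ μ) {Cp Cq : ℝ≥0∞} (hCp : Cp ≠ ⊤) (hCq : Cq ≠ ⊤)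
    (Hp : ∀ c : ℝ → ℝ, eLpNorm (fun x => ∑ a ∈ f.range, c a * ψ a x) (ENNReal.ofReal p) μ ≤
      Cp * eLpNorm (fun x => c (f x)) (ENNReal.ofReal p) μ)
    (Hq : ∀ c : ℝ → ℝ, eLpNorm (fun x => ∑ a ∈ f.range, c a * ψ a x) (ENNReal.ofReal q) μ ≤
      Cq * eLpNorm (fun x => c (f x)) (ENNReal.ofReal q) μ) :
    eLpNorm (fun x => ∑ a ∈ f.range, a * ψ a x) (ENNReal.ofReal r) μ ≤
      Cp ^ θ * Cq ^ (1 - θ) * eLpNorm f (ENNReal.ofReal r) μ := by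
  have hp0 := hpp.pos
  have hq0 := hqq.pos
  have hr0 := hrr.pos
  have hp0' := hpp.symm.pos
  have hq0' := hqq.symm.pos
  have hr0' := hrr.symm.pos
  -- The conjugate exponents interpolate with the same `θ`, so the test function `g` can be deformed
  -- analytically alongside `f`.
  have hr' : 1 / r' = θ / p' + (1 - θ) / q' := by
    have e1 := hpp.inv_add_inv_eq_one
    have e2 := hqq.inv_add_inv_eq_one
    have e3 := hrr.inv_add_inv_eq_one
    simp only [div_eq_mul_inv, one_mul] at hr ⊢
    linear_combination e3 - θ * e1 - (1 - θ) * e2 - hr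
  have hmem : MemLp (fun x => ∑ a ∈ f.range, a * ψ a x) ⊤ μ :=
    memLp_finsetSum _ fun a _ => (hψ a).const_mul a
  refine eLpNorm_le_of_simpleFunc hrr.symm (hmem.mono_exponent le_top) fun g => ?_
  set A := (eLpNorm f (ENNReal.ofReal r) μ).toReal with hA
  set B := (eLpNorm g (ENNReal.ofReal r') μ).toReal with hB
  have hA0 : 0 ≤ A := ENNReal.toReal_nonneg
  have hB0 : 0 ≤ B := ENNReal.toReal_nonneg
  set Φ : ℂ → ℂ := fun z => ∫ x, (∑ a ∈ f.range, analyticPower r p q a z * (ψ a x : ℂ)) *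
      analyticPower r' p' q' (g x) z ∂μ with hΦ
  have hint : ∀ a b, Integrable (fun x => (ψ a x : ℂ) * (if g x = b then 1 else 0)) μ := by
    intro a b
    have h1 : Integrable (fun x => (ψ a x : ℂ)) μ :=
      (memLp_one_iff_integrable.1 ((hψ a).mono_exponent le_top)).ofReal
    refine h1.mul_bdd (c := 1)
      ((g.map fun y => if y = b then (1 : ℂ) else 0).aestronglyMeasurable) ?_
    refine Filter.Eventually.of_forall fun x => ?_
    split_ifs <;> simp
  -- Since `f` and `g` take finitely many values, `Φ` is a finite combination of products of
  -- analytic powers with constant coefficients; holomorphy and boundedness on the strip follow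
  -- termwise.
  have hsum : ∀ z, Φ z = ∑ a ∈ f.range, ∑ b ∈ g.range, analyticPower r p q a z *
      analyticPower r' p' q' b z * ∫ x, (ψ a x : ℂ) * (if g x = b then 1 else 0) ∂μ := by
    intro z
    simp only [hΦ]
    simp_rw [← integral_const_mul]
    have hii : ∀ a b, Integrable (fun x => analyticPower r p q a z * analyticPower r' p' q' b z *
        ((ψ a x : ℂ) * (if g x = b then 1 else 0))) μ := fun a b => (hint a b).const_mul _
    rw [Finset.sum_congr rfl fun a _ => (integral_finsetSum _ fun b _ => hii a b).symm,
      ← integral_finsetSum _ fun a _ => integrable_finsetSum _ fun b _ => hii a b]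
    congr 1; ext x
    rw [Finset.sum_mul]
    refine Finset.sum_congr rfl fun a _ => ?_
    rw [Finset.sum_eq_single (g x)]
    · simp; ring
    · intro b _ hb; simp [hb.symm]
    · intro hcon; exact (hcon (SimpleFunc.mem_range_self g x)).elim
  have hdiff : Differentiable ℂ Φ := by
    rw [funext hsum]
    refine Differentiable.fun_sum fun a _ => Differentiable.fun_sum fun b _ => ?_
    exact ((differentiable_analyticPower _ _ _ _).mul
      (differentiable_analyticPower _ _ _ _)).mul_const _
  have hbdd : BddAbove (norm ∘ Φ '' Complex.HadamardThreeLines.verticalClosedStrip 0 1) := by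
    refine ⟨∑ a ∈ f.range, ∑ b ∈ g.range, (1 + |a|) ^ (r * (1 / p + 1 / q)) *
      (1 + |b|) ^ (r' * (1 / p' + 1 / q')) *
        ‖∫ x, (ψ a x : ℂ) * (if g x = b then 1 else 0) ∂μ‖, ?_⟩
    rintro _ ⟨z, hz, rfl⟩
    simp only [Function.comp, hsum]
    refine (norm_sum_le _ _).trans (Finset.sum_le_sum fun a _ =>
      (norm_sum_le _ _).trans (Finset.sum_le_sum fun b _ => ?_))
    rw [norm_mul, norm_mul]
    have hz0 : 0 ≤ z.re := hz.1
    have hz1 : z.re ≤ 1 := hz.2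
    gcongr
    · exact norm_analyticPower_le hr0.le hp0 hq0 hz0 hz1
    · exact norm_analyticPower_le hr0'.le hp0' hq0' hz0 hz1
  have hmem : (θ : ℂ) ∈ Complex.HadamardThreeLines.verticalClosedStrip 0 1 := by
    simp [Complex.HadamardThreeLines.verticalClosedStrip, hθ0.le, hθ1.le]
  -- The edge `Re z = 0` carries the exponent `q`, the edge `Re z = 1` the exponent `p`.
  have h3 := Complex.HadamardThreeLines.norm_le_interp_of_mem_verticalClosedStrip₀₁' Φ
    (a := Cq.toReal * A ^ (r / q) * B ^ (r' / q')) (b := Cp.toReal * A ^ (r / p) * B ^ (r' / p'))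
    hmem hdiff.diffContOnCl hbdd
    (fun z hz => by
      have hz : z.re = 0 := hz
      exact norm_integral_analyticPower_le hr0 hr0' hqq (by simp [hz]) (by simp [hz]) f g
        (fun a => (hψ a).1) hCq Hq)
    (fun z hz => by
      have hz : z.re = 1 := hz
      exact norm_integral_analyticPower_le hr0 hr0' hpp (by simp [hz]) (by simp [hz]) f g
        (fun a => (hψ a).1) hCp Hp)
  have hΦθ : Φ θ = ((∫ x, (∑ a ∈ f.range, a * ψ a x) * g x ∂μ : ℝ) : ℂ) := by
    simp only [hΦ]
    rw [← integral_complex_ofReal]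
    congr 1; ext x
    rw [analyticPower_of_eq_one (by rw [← hr']; field_simp)]
    push_cast
    congr 1
    refine Finset.sum_congr rfl fun a _ => ?_
    rw [analyticPower_of_eq_one (by rw [← hr]; field_simp)]
  -- The powers of `A` and of `B` recombine to exponent one by the relations defining `r` and `r'`.
  have hexp : (Cq.toReal * A ^ (r / q) * B ^ (r' / q')) ^ (1 - θ) *
      (Cp.toReal * A ^ (r / p) * B ^ (r' / p')) ^ θ =
      Cp.toReal ^ θ * Cq.toReal ^ (1 - θ) * A * B := by
    have hCp0 : 0 ≤ Cp.toReal := ENNReal.toReal_nonneg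
    have hCq0 : 0 ≤ Cq.toReal := ENNReal.toReal_nonneg
    have hth : 0 < 1 - θ := by linarith
    rw [Real.mul_rpow (by positivity) (by positivity), Real.mul_rpow (by positivity) (by positivity),
      Real.mul_rpow (by positivity) (by positivity), Real.mul_rpow (by positivity) (by positivity),
      ← Real.rpow_mul hA0, ← Real.rpow_mul hA0, ← Real.rpow_mul hB0, ← Real.rpow_mul hB0]
    have eA : A ^ (r / q * (1 - θ)) * A ^ (r / p * θ) = A := by
      rw [← Real.rpow_add_of_nonneg hA0 (by positivity) (by positivity)]
      have : r / q * (1 - θ) + r / p * θ = r * (1 / r) := by rw [hr]; ring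
      rw [this, mul_one_div_cancel hr0.ne', Real.rpow_one]
    have eB : B ^ (r' / q' * (1 - θ)) * B ^ (r' / p' * θ) = B := by
      rw [← Real.rpow_add_of_nonneg hB0 (by positivity) (by positivity)]
      have : r' / q' * (1 - θ) + r' / p' * θ = r' * (1 / r') := by rw [hr']; ring
      rw [this, mul_one_div_cancel hr0'.ne', Real.rpow_one]
    calc _ = Cp.toReal ^ θ * Cq.toReal ^ (1 - θ) * (A ^ (r / q * (1 - θ)) * A ^ (r / p * θ)) *
          (B ^ (r' / q' * (1 - θ)) * B ^ (r' / p' * θ)) := by ring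
      _ = _ := by rw [eA, eB]
  rw [Complex.ofReal_re, hexp, hΦθ, Complex.norm_real] at h3
  have hMfin : Cp ^ θ * Cq ^ (1 - θ) * eLpNorm f (ENNReal.ofReal r) μ *
      eLpNorm g (ENNReal.ofReal r') μ ≠ ⊤ :=
    ENNReal.mul_ne_top (ENNReal.mul_ne_top (ENNReal.mul_ne_top
      (ENNReal.rpow_ne_top_of_nonneg hθ0.le hCp)
      (ENNReal.rpow_ne_top_of_nonneg (by linarith) hCq)) (simpleFunc_eLpNorm_ne_top f _))
      (simpleFunc_eLpNorm_ne_top g _)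
  rw [← ENNReal.ofReal_toReal hMfin]
  refine ENNReal.ofReal_le_ofReal ((le_abs_self _).trans (h3.trans (le_of_eq ?_)))
  simp [ENNReal.toReal_mul, ENNReal.toReal_rpow, hA, hB]

end RieszThorin

/-! ### The chain rule in `H¹(Ω)` by mollification -/

section ChainRule

open Filter Topology

/-- Dominated convergence with a convergent sequence of dominating functions. -/
theorem tendsto_integral_of_tendsto_bound {X : Type*} [MeasurableSpace X] {μ : Measure X}
    {f w : ℕ → X → ℝ} {f₀ w₀ : X → ℝ} (hf : ∀ n, AEStronglyMeasurable (f n) μ)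
    (hw : ∀ n, Integrable (w n) μ) (hw₀ : Integrable w₀ μ) (hfw : ∀ n, ∀ᵐ x ∂μ, |f n x| ≤ w n x)
    (hlim : ∀ᵐ x ∂μ, Tendsto (fun n => f n x) atTop (𝓝 (f₀ x)))
    (hwlim : ∀ᵐ x ∂μ, Tendsto (fun n => w n x) atTop (𝓝 (w₀ x)))
    (hwint : Tendsto (fun n => ∫ x, w n x ∂μ) atTop (𝓝 (∫ x, w₀ x ∂μ))) :
    Tendsto (fun n => ∫ x, f n x ∂μ) atTop (𝓝 (∫ x, f₀ x ∂μ)) := by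
  have hall : ∀ᵐ x ∂μ, ∀ n, |f n x| ≤ w n x := ae_all_iff.2 hfw
  have hfi : ∀ n, Integrable (f n) μ := fun n => (hw n).mono' (hf n) (hfw n)
  have hf₀ : ∀ᵐ x ∂μ, |f₀ x| ≤ w₀ x := by
    filter_upwards [hall, hlim, hwlim] with x h1 h2 h3
    exact le_of_tendsto_of_tendsto' h2.abs h3 h1
  -- Clamping `f n` to `[-w₀, w₀]` allows ordinary dominated convergence. The error is at most `(w n
  -- - w₀)⁺ = (w n - w₀) + (w₀ - w n)⁺`; the first term has integral tending to zero by `hwint`, the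
  -- second is dominated by `w₀`.
  set g : ℕ → X → ℝ := fun n x => max (-w₀ x) (min (w₀ x) (f n x)) with hg
  have hgm : ∀ n, AEStronglyMeasurable (g n) μ := fun n =>
    hw₀.1.neg.sup (hw₀.1.inf (hf n))
  have hgw : ∀ n, ∀ᵐ x ∂μ, ‖g n x‖ ≤ w₀ x := by
    intro n
    filter_upwards [hf₀] with x hx
    have h0 : 0 ≤ w₀ x := (abs_nonneg _).trans hx
    rw [Real.norm_eq_abs, abs_le]
    exact ⟨le_max_left _ _, max_le (by linarith) (min_le_left _ _)⟩
  have hgi : ∀ n, Integrable (g n) μ := fun n => hw₀.mono' (hgm n) (hgw n)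
  have hgt : Tendsto (fun n => ∫ x, g n x ∂μ) atTop (𝓝 (∫ x, f₀ x ∂μ)) := by
    refine tendsto_integral_of_dominated_convergence w₀ hgm hw₀ hgw ?_
    filter_upwards [hlim, hf₀] with x h1 h2
    have h3 : max (-w₀ x) (min (w₀ x) (f₀ x)) = f₀ x := by
      rw [abs_le] at h2
      rw [min_eq_right h2.2, max_eq_right h2.1]
    rw [← h3]
    exact tendsto_const_nhds.max (tendsto_const_nhds.min h1)
  have hneg : Tendsto (fun n => ∫ x, max (w₀ x - w n x) 0 ∂μ) atTop (𝓝 0) := by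
    have := tendsto_integral_of_dominated_convergence (μ := μ)
      (F := fun n x => max (w₀ x - w n x) 0) (f := fun _ => (0 : ℝ)) w₀
      (fun n => (hw₀.1.sub (hw n).1).sup aestronglyMeasurable_const) hw₀ (fun n => by
        filter_upwards [hall, hf₀] with x h1 h2
        have h3 := (abs_nonneg _).trans (h1 n)
        have h4 := (abs_nonneg _).trans h2
        rw [Real.norm_eq_abs, abs_of_nonneg (le_max_right _ _)]
        exact max_le (by linarith) h4) (by
        filter_upwards [hwlim] with x hx
        have : Tendsto (fun n => max (w₀ x - w n x) 0) atTop (𝓝 (max (w₀ x - w₀ x) 0)) :=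
          (tendsto_const_nhds.sub hx).max tendsto_const_nhds
        simpa using this)
    simpa using this
  have hpos : Tendsto (fun n => (∫ x, w n x ∂μ) - (∫ x, w₀ x ∂μ) +
      ∫ x, max (w₀ x - w n x) 0 ∂μ) atTop (𝓝 0) := by
    simpa using (hwint.sub_const (∫ x, w₀ x ∂μ)).add hneg
  have hdiff : Tendsto (fun n => (∫ x, f n x ∂μ) - ∫ x, g n x ∂μ) atTop (𝓝 0) := by
    refine squeeze_zero_norm (fun n => ?_) hpos
    have hmi : Integrable (fun x => max (w₀ x - w n x) 0) μ := (hw₀.sub (hw n)).pos_part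
    have hsi : Integrable (fun x => w n x - w₀ x) μ := (hw n).sub hw₀
    rw [← integral_sub (hfi n) (hgi n), ← integral_sub (hw n) hw₀, ← integral_add hsi hmi]
    refine norm_integral_le_of_norm_le (hsi.add hmi) ?_
    filter_upwards [hall, hf₀] with x h1 h2
    have h3 := h1 n
    have h4 := (abs_nonneg _).trans h2
    simp only [hg, Real.norm_eq_abs]
    rw [abs_le] at h3 ⊢
    rcases max_cases (-w₀ x) (min (w₀ x) (f n x)) with ⟨e1, _⟩ | ⟨e1, _⟩ <;>
    rcases min_cases (w₀ x) (f n x) with ⟨e2, _⟩ | ⟨e2, _⟩ <;>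
    rcases max_cases (w₀ x - w n x) 0 with ⟨e3, _⟩ | ⟨e3, _⟩ <;>
    constructor <;> linarith
  simpa using hgt.add hdiff

variable {d : ℕ}

open scoped Convolution

theorem IsH1.integrable_inner {Ω : Set (E d)} [IsFiniteMeasure (volume.restrict Ω)]
    {u : E d → ℝ} {v : E d → E d} (h : IsH1 Ω u v) (e : E d) :
    IntegrableOn (fun x => inner ℝ (v x) e) Ω volume :=
  (h.memLp_grad.integrable one_le_two).inner_const e

theorem IsH1.integrable {Ω : Set (E d)} [IsFiniteMeasure (volume.restrict Ω)]
    {u : E d → ℝ} {v : E d → E d} (h : IsH1 Ω u v) : IntegrableOn u Ω volume :=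
  h.memLp.integrable one_le_two

/-- Mollification commutes with the weak gradient away from the boundary. -/
theorem IsH1.fderiv_convolution {Ω : Set (E d)} (hΩ : IsOpen Ω)
    [IsFiniteMeasure (volume.restrict Ω)]
    {u : E d → ℝ} {v : E d → E d} (h : IsH1 Ω u v) (φ : ContDiffBump (0 : E d)) {x : E d}
    (hx : Metric.closedBall x φ.rOut ⊆ Ω) (e : E d) :
    fderiv ℝ (φ.normed volume ⋆[ContinuousLinearMap.lsmul ℝ ℝ, volume] Ω.indicator u) x e =
      (φ.normed volume ⋆[ContinuousLinearMap.lsmul ℝ ℝ, volume]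
        Ω.indicator (fun y => inner ℝ (v y) e)) x := by
  have hU : LocallyIntegrable (Ω.indicator u) volume :=
    ((integrable_indicator_iff hΩ.measurableSet).2 h.integrable).locallyIntegrable
  have hφ1 : ContDiff ℝ 1 (φ.normed volume) := φ.contDiff_normed
  have hφc : HasCompactSupport (φ.normed volume) := φ.hasCompactSupport_normed
  have hex : ConvolutionExistsAt (fderiv ℝ (φ.normed volume)) (Ω.indicator u) x
      (ContinuousLinearMap.precompL (E d) (ContinuousLinearMap.lsmul ℝ ℝ)) volume :=
    (hφc.fderiv ℝ).convolutionExists_left _ (hφ1.continuous_fderiv one_ne_zero) hU x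
  rw [(hφc.hasFDerivAt_convolution_left (ContinuousLinearMap.lsmul ℝ ℝ) hφ1 hU x).fderiv]
  rw [convolution_def, ContinuousLinearMap.integral_apply hex, convolution_def]
  have e1 : ∀ t, (ContinuousLinearMap.precompL (E d) (ContinuousLinearMap.lsmul ℝ ℝ)
      (fderiv ℝ (φ.normed volume) t) (Ω.indicator u (x - t))) e =
      Ω.indicator u (x - t) * fderiv ℝ (φ.normed volume) t e := by
    intro t
    simp [mul_comm]
  simp only [e1]
  rw [← integral_sub_left_eq_self _ volume x,
    ← integral_sub_left_eq_self (fun t => (ContinuousLinearMap.lsmul ℝ ℝ) (φ.normed volume t) _)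
      volume x]
  simp only [sub_sub_cancel]
  -- The reflected, translated bump is a legitimate test function because its support lies in the
  -- closed ball contained in `Ω`.
  set ζ : E d → ℝ := fun y => φ.normed volume (x - y) with hζ
  have hζd : ContDiff ℝ (⊤ : ℕ∞) ζ := φ.contDiff_normed.comp (contDiff_const.sub contDiff_id)
  have hζs : Function.support ζ ⊆ Metric.closedBall x φ.rOut := by
    intro y hy
    have : x - y ∈ Function.support (φ.normed volume) := hy
    rw [φ.support_normed_eq, mem_ball_zero_iff] at this
    rw [Metric.mem_closedBall, dist_comm, dist_eq_norm]
    exact this.le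
  have hζt : tsupport ζ ⊆ Metric.closedBall x φ.rOut :=
    closure_minimal hζs Metric.isClosed_closedBall
  have hζc : HasCompactSupport ζ :=
    (isCompact_closedBall x φ.rOut).of_isClosed_subset (isClosed_tsupport _) hζt
  have hζf : ∀ y, fderiv ℝ ζ y e = - fderiv ℝ (φ.normed volume) (x - y) e := by
    intro y
    have hd : HasFDerivAt (φ.normed volume) (fderiv ℝ (φ.normed volume) (x - y)) (x - y) :=
      (hφ1.differentiable one_ne_zero _).hasFDerivAt
    have := hd.comp y ((hasFDerivAt_id y).const_sub x)
    have h2 : fderiv ℝ ζ y = _ := this.fderiv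
    rw [h2]; simp
  have hw := h.weak_grad ζ hζd hζc (hζt.trans hx) e
  simp only [hζf, mul_neg, integral_neg] at hw
  rw [neg_inj] at hw
  calc ∫ y, Ω.indicator u y * fderiv ℝ (φ.normed volume) (x - y) e
      = ∫ y in Ω, u y * fderiv ℝ (φ.normed volume) (x - y) e := by
        rw [← integral_indicator hΩ.measurableSet]
        congr 1; ext y
        by_cases hy : y ∈ Ω <;> simp [hy]
    _ = ∫ y in Ω, ζ y * inner ℝ (v y) e := hw
    _ = _ := by
        rw [← integral_indicator hΩ.measurableSet]
        congr 1; ext y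
        by_cases hy : y ∈ Ω <;> simp [hy, hζ]

/-- The `L¹` convergence of mollifications, in the form of convergence of weighted integrals. -/
theorem tendsto_integral_mul_convolution {V : E d → ℝ} (hV : Integrable V volume)
    {φ : ℕ → ContDiffBump (0 : E d)} (hφ : Tendsto (fun n => (φ n).rOut) atTop (𝓝 0)) {K : ℝ}
    (hφK : ∀ n, (φ n).rOut ≤ K * (φ n).rIn) {c : ℕ → E d → ℝ} {c₀ : E d → ℝ} {C : ℝ}
    (hcm : ∀ n, AEStronglyMeasurable (c n) volume) (hcb : ∀ n x, |c n x| ≤ C)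
    (hclim : ∀ᵐ x, Tendsto (fun n => c n x) atTop (𝓝 (c₀ x))) :
    Tendsto (fun n => ∫ x, c n x *
        ((φ n).normed volume ⋆[ContinuousLinearMap.lsmul ℝ ℝ, volume] V) x) atTop
      (𝓝 (∫ x, c₀ x * V x)) := by
  have hC : 0 ≤ C := (abs_nonneg _).trans (hcb 0 0)
  have hn : ∀ n, Integrable ((φ n).normed volume) volume := fun n => (φ n).integrable_normed
  have hci : ∀ {W : E d → ℝ}, Integrable W volume → ∀ n, Integrable
      ((φ n).normed volume ⋆[ContinuousLinearMap.lsmul ℝ ℝ, volume] W) volume := fun hW n =>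
    (hn n).integrable_convolution _ hW
  have hae : ∀ {W : E d → ℝ}, Integrable W volume → ∀ᵐ x, Tendsto (fun n =>
      ((φ n).normed volume ⋆[ContinuousLinearMap.lsmul ℝ ℝ, volume] W) x) atTop (𝓝 (W x)) :=
    fun hW => ContDiffBump.ae_convolution_tendsto_right_of_locallyIntegrable hφ
      (Eventually.of_forall hφK) hW.locallyIntegrable
  -- The majorants are `C` times the mollifications of `|V|`; each has integral exactly `C ∫ |V|`.
  refine tendsto_integral_of_tendsto_bound
    (w := fun n x => C * ((φ n).normed volume ⋆[ContinuousLinearMap.lsmul ℝ ℝ, volume]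
      (fun y => |V y|)) x) (w₀ := fun x => C * |V x|)
    (fun n => (hcm n).mul (hci hV n).1) (fun n => (hci hV.abs n).const_mul C)
    (hV.abs.const_mul C) (fun n => ?_) ?_ ?_ ?_
  · refine Eventually.of_forall fun x => ?_
    rw [abs_mul]
    refine mul_le_mul (hcb n x) ?_ (abs_nonneg _) hC
    rw [convolution_def, convolution_def, ← Real.norm_eq_abs]
    refine (norm_integral_le_integral_norm _).trans (le_of_eq ?_)
    congr 1; ext t
    simp [abs_of_nonneg ((φ n).nonneg_normed t)]
  · filter_upwards [hclim, hae hV] with x h1 h2 using h1.mul h2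
  · filter_upwards [hae hV.abs] with x h2 using h2.const_mul C
  · refine tendsto_const_nhds.congr fun n => ?_
    rw [integral_const_mul, integral_const_mul, integral_convolution _ (hn n) hV.abs,
      (φ n).integral_normed]
    simp

/-- The chain rule in `H¹(Ω)` for bounded `C¹` functions with bounded derivative. -/
theorem IsH1.comp {Ω : Set (E d)} (hΩ : IsOpen Ω) [IsFiniteMeasure (volume.restrict Ω)]
    {u : E d → ℝ} {v : E d → E d} (h : IsH1 Ω u v) {f : ℝ → ℝ} (hf : ContDiff ℝ 1 f) {C : ℝ}
    (hfC : ∀ s, |f s| ≤ C) (hfC' : ∀ s, |deriv f s| ≤ C) :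
    IsH1 Ω (fun x => f (u x)) (fun x => deriv f (u x) • v x) := by
  have hf'c : Continuous (deriv f) := hf.continuous_deriv le_rfl
  have hfm : AEStronglyMeasurable (fun x => f (u x)) (volume.restrict Ω) :=
    hf.continuous.comp_aestronglyMeasurable h.memLp.1
  have hfm' : AEStronglyMeasurable (fun x => deriv f (u x)) (volume.restrict Ω) :=
    hf'c.comp_aestronglyMeasurable h.memLp.1
  refine ⟨MemLp.of_bound hfm C (Eventually.of_forall fun x => hfC _),
    h.memLp_grad.of_le_mul (c := C) (hfm'.smul h.memLp_grad.1)
      (Eventually.of_forall fun x => by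
        rw [norm_smul]; exact mul_le_mul_of_nonneg_right (hfC' _) (norm_nonneg _)), ?_⟩
  intro ζ hζ hζc hζΩ e
  -- Mollifying at radius at most `δ` keeps every ball centred in the support of `ζ` inside `Ω`, so
  -- there the gradient of the mollified function is the mollified weak gradient.
  obtain ⟨δ, hδ, hδΩ⟩ := hζc.exists_cthickening_subset_open hΩ hζΩ
  set U := Ω.indicator u with hU
  set V := Ω.indicator (fun y => inner ℝ (v y) e) with hV
  have hUi : Integrable U volume := (integrable_indicator_iff hΩ.measurableSet).2 h.integrable
  have hVi : Integrable V volume :=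
    (integrable_indicator_iff hΩ.measurableSet).2 (h.integrable_inner e)
  have hpos : ∀ n : ℕ, 0 < δ / (n + 1) := fun n => by positivity
  set φ : ℕ → ContDiffBump (0 : E d) := fun n =>
    ⟨δ / (n + 1) / 2, δ / (n + 1), by have := hpos n; linarith, by have := hpos n; linarith⟩ with hφ
  have hφ0 : Tendsto (fun n => (φ n).rOut) atTop (𝓝 0) := by
    have := (tendsto_one_div_add_atTop_nhds_zero_nat (𝕜 := ℝ)).const_mul δ
    rw [mul_zero] at this
    refine this.congr fun n => ?_
    simp [hφ, div_eq_mul_inv]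
  have hφK : ∀ n, (φ n).rOut ≤ 2 * (φ n).rIn := fun n => by
    simp only [hφ]; linarith
  have hφδ : ∀ n, (φ n).rOut ≤ δ := fun n => by
    simp only [hφ]
    exact div_le_self hδ.le (by linarith [(Nat.cast_nonneg n : (0 : ℝ) ≤ n)])
  set un : ℕ → E d → ℝ := fun n =>
    (φ n).normed volume ⋆[ContinuousLinearMap.lsmul ℝ ℝ, volume] U with hun
  have hund : ∀ n, ContDiff ℝ 1 (un n) := fun n =>
    (φ n).hasCompactSupport_normed.contDiff_convolution_left (n := 1) _ (φ n).contDiff_normed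
      hUi.locallyIntegrable
  have hunlim : ∀ᵐ x, Tendsto (fun n => un n x) atTop (𝓝 (U x)) :=
    ContDiffBump.ae_convolution_tendsto_right_of_locallyIntegrable hφ0
      (Eventually.of_forall hφK) hUi.locallyIntegrable
  have hζ' : Continuous fun x => fderiv ℝ ζ x e :=
    (hζ.continuous_fderiv (by simp)).clm_apply continuous_const
  have hζ'c : HasCompactSupport fun x => fderiv ℝ ζ x e := hζc.fderiv_apply ℝ e
  obtain ⟨B, hB⟩ := hζc.exists_bound_of_continuous hζ.continuous
  have hB0 : 0 ≤ B := (norm_nonneg _).trans (hB 0)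
  have hC0 : 0 ≤ C := (abs_nonneg _).trans (hfC 0)
  have hfun : ∀ n, ContDiff ℝ 1 (fun x => f (un n x)) := fun n => hf.comp (hund n)
  have hparts : ∀ n, ∫ x, f (un n x) * fderiv ℝ ζ x e = - ∫ x, (ζ x * deriv f (un n x)) *
      ((φ n).normed volume ⋆[ContinuousLinearMap.lsmul ℝ ℝ, volume] V) x := by
    intro n
    rw [integral_mul_fderiv_eq_neg_fderiv_mul_of_integrable]
    · congr 1
      refine integral_congr_ae (Eventually.of_forall fun x => ?_)
      dsimp only
      by_cases hx : x ∈ tsupport ζ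
      · have hd : HasFDerivAt (fun x => f (un n x))
            (deriv f (un n x) • fderiv ℝ (un n) x) x :=
          ((hf.differentiable one_ne_zero _).hasDerivAt).comp_hasFDerivAt x
            ((hund n).differentiable one_ne_zero x).hasFDerivAt
        have hball : Metric.closedBall x (φ n).rOut ⊆ Ω :=
          (Metric.closedBall_subset_closedBall (hφδ n)).trans
            ((Metric.closedBall_subset_cthickening hx δ).trans hδΩ)
        rw [hd.fderiv, smul_apply, hun,
          h.fderiv_convolution hΩ (φ n) hball e, smul_eq_mul]
        ring
      · simp [image_eq_zero_of_notMem_tsupport hx]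
    · exact ((((hfun n).continuous_fderiv one_ne_zero).clm_apply continuous_const).mul
        hζ.continuous).integrable_of_hasCompactSupport hζc.mul_left
    · exact ((hfun n).continuous.mul hζ').integrable_of_hasCompactSupport hζ'c.mul_left
    · exact ((hfun n).continuous.mul hζ.continuous).integrable_of_hasCompactSupport hζc.mul_left
    · exact fun x _ => (hfun n).differentiable one_ne_zero x
    · exact fun x _ => hζ.differentiable (by simp) x
  have hlim1 : Tendsto (fun n => ∫ x, f (un n x) * fderiv ℝ ζ x e) atTop
      (𝓝 (∫ x, f (U x) * fderiv ℝ ζ x e)) := by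
    refine tendsto_integral_of_dominated_convergence (fun x => C * |fderiv ℝ ζ x e|)
      (fun n => ((hfun n).continuous.mul hζ').aestronglyMeasurable)
      ((hζ'.integrable_of_hasCompactSupport hζ'c).abs.const_mul C)
      (fun n => Eventually.of_forall fun x => ?_) ?_
    · rw [norm_mul, Real.norm_eq_abs, Real.norm_eq_abs]
      exact mul_le_mul_of_nonneg_right (hfC _) (abs_nonneg _)
    · filter_upwards [hunlim] with x hx
      exact ((hf.continuous.tendsto _).comp hx).mul_const _
  -- The mollified gradients have no fixed dominating function; their coefficients `ζ f'(un)` are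
  -- bounded and converge almost everywhere, which is what this limit theorem needs.
  have hlim2 := tendsto_integral_mul_convolution hVi hφ0 hφK
    (c := fun n x => ζ x * deriv f (un n x)) (c₀ := fun x => ζ x * deriv f (U x)) (C := B * C)
    (fun n => (hζ.continuous.mul (hf'c.comp (hund n).continuous)).aestronglyMeasurable)
    (fun n x => by
      rw [abs_mul]
      exact mul_le_mul (hB x) (hfC' _) (abs_nonneg _) hB0)
    (by
      filter_upwards [hunlim] with x hx
      exact ((hf'c.tendsto _).comp hx).const_mul _)
  have hmain := tendsto_nhds_unique hlim1 (hlim2.neg.congr fun n => (hparts n).symm)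
  have hl : ∫ x in Ω, f (u x) * fderiv ℝ ζ x e = ∫ x, f (U x) * fderiv ℝ ζ x e := by
    rw [← integral_indicator hΩ.measurableSet]
    refine integral_congr_ae (Eventually.of_forall fun x => ?_)
    by_cases hx : x ∈ Ω
    · simp [hx, hU]
    · have : fderiv ℝ ζ x e = 0 :=
        image_eq_zero_of_notMem_tsupport (f := fun x => fderiv ℝ ζ x e)
          fun hcon => hx (hζΩ (tsupport_fderiv_apply_subset ℝ e hcon))
      simp [hx, this]
  rw [hl, hmain, ← integral_indicator hΩ.measurableSet]
  congr 1
  refine integral_congr_ae (Eventually.of_forall fun x => ?_)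
  by_cases hx : x ∈ Ω
  · simp [hx, hU, hV, real_inner_smul_left]; ring
  · simp [hx, hV]

end ChainRule

/-! ### The Neumann resolvent: existence in `H¹` and the maximum principle -/

section Resolvent

variable {d : ℕ} {Ω : Set (E d)}

theorem MemLp.integrable_mul_two {X : Type*} [MeasurableSpace X] {μ : Measure X} {f g : X → ℝ}
    (hf : MemLp f 2 μ) (hg : MemLp g 2 μ) : Integrable (fun x => f x * g x) μ :=
  hf.integrable_mul hg

theorem MemLp.integrable_inner_two {X F : Type*} [MeasurableSpace X] {μ : Measure X}
    [NormedAddCommGroup F] [InnerProductSpace ℝ F] {f g : X → F}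
    (hf : MemLp f 2 μ) (hg : MemLp g 2 μ) : Integrable (fun x => inner ℝ (f x) (g x)) μ := by
  refine (hf.norm.integrable_mul hg.norm).mono (hf.1.inner hg.1) ?_
  refine Filter.Eventually.of_forall fun x => ?_
  simpa using norm_inner_le_norm (𝕜 := ℝ) (f x) (g x)

theorem memLp_fderiv_test {ζ : E d → ℝ} (hζ : ContDiff ℝ (⊤ : ℕ∞) ζ) (hc : HasCompactSupport ζ)
    (e : E d) (p : ℝ≥0∞) : MemLp (fun x => fderiv ℝ ζ x e) p (volume.restrict Ω) :=
  (((hζ.continuous_fderiv (by simp)).clm_apply continuous_const).memLp_of_hasCompactSupport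
    (hc.fderiv_apply ℝ e)).restrict Ω

theorem IsH1.congr {u u' : E d → ℝ} {v v' : E d → E d} (h : IsH1 Ω u v)
    (hu : u =ᵐ[volume.restrict Ω] u') (hv : v =ᵐ[volume.restrict Ω] v') : IsH1 Ω u' v' := by
  refine ⟨h.memLp.ae_eq hu, h.memLp_grad.ae_eq hv, fun ζ h1 h2 h3 e => ?_⟩
  have := h.weak_grad ζ h1 h2 h3 e
  rw [integral_congr_ae (g := fun x => u' x * fderiv ℝ ζ x e)
    (hu.mono fun x hx => by dsimp only; rw [hx]),
    integral_congr_ae (f := fun x => ζ x * inner ℝ (v x) e) (g := fun x => ζ x * inner ℝ (v' x) e)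
    (hv.mono fun x hx => by dsimp only; rw [hx])] at this
  exact this

theorem IsH1.const_mul {u : E d → ℝ} {v : E d → E d} (h : IsH1 Ω u v) (c : ℝ) :
    IsH1 Ω (fun x => c * u x) (fun x => c • v x) := by
  refine ⟨h.memLp.const_mul c, h.memLp_grad.const_smul c, fun ζ h1 h2 h3 e => ?_⟩
  have := h.weak_grad ζ h1 h2 h3 e
  simp only [real_inner_smul_left, mul_assoc, mul_left_comm _ c, integral_const_mul, this]
  ring

theorem IsH1.add {u u' : E d → ℝ} {v v' : E d → E d} (h : IsH1 Ω u v) (h' : IsH1 Ω u' v') :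
    IsH1 Ω (fun x => u x + u' x) (fun x => v x + v' x) := by
  refine ⟨h.memLp.add h'.memLp, h.memLp_grad.add h'.memLp_grad, fun ζ h1 h2 h3 e => ?_⟩
  have e1 := h.weak_grad ζ h1 h2 h3 e
  have e2 := h'.weak_grad ζ h1 h2 h3 e
  have hζ := memLp_fderiv_test (Ω := Ω) h1 h2 e 2
  have hζe : MemLp (fun x => ζ x • e) 2 (volume.restrict Ω) :=
    ((h1.continuous.smul continuous_const).memLp_of_hasCompactSupport (h2.smul_right)).restrict Ω
  have hi : ∀ {w : E d → E d}, MemLp w 2 (volume.restrict Ω) →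
      Integrable (fun x => ζ x * inner ℝ (w x) e) (volume.restrict Ω) := by
    intro w hw
    simpa [real_inner_smul_right] using MemLp.integrable_inner_two hw hζe
  simp only [inner_add_left, add_mul, mul_add]
  rw [integral_add (MemLp.integrable_mul_two h.memLp hζ) (MemLp.integrable_mul_two h'.memLp hζ),
    integral_add (hi h.memLp_grad) (hi h'.memLp_grad), e1, e2]
  ring

theorem IsVariationalNeumann.memLp {φ g : E d → ℝ} (h : IsVariationalNeumann Ω φ g) :
    MemLp φ 2 (volume.restrict Ω) := by
  obtain ⟨_, v, hv, _⟩ := h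
  exact hv.memLp

theorem IsVariationalNeumann.const_mul {φ g : E d → ℝ} (h : IsVariationalNeumann Ω φ g) (c : ℝ) :
    IsVariationalNeumann Ω (fun x => c * φ x) (fun x => c * g x) := by
  obtain ⟨hg, v, hv, hvar⟩ := h
  refine ⟨hg.const_mul c, _, hv.const_mul c, fun η w hw => ?_⟩
  simp only [real_inner_smul_left, mul_assoc, integral_const_mul, hvar η w hw]
  ring

theorem IsVariationalNeumann.add {φ g φ' g' : E d → ℝ} (h : IsVariationalNeumann Ω φ g)
    (h' : IsVariationalNeumann Ω φ' g') :
    IsVariationalNeumann Ω (fun x => φ x + φ' x) (fun x => g x + g' x) := by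
  obtain ⟨hg, v, hv, hvar⟩ := h
  obtain ⟨hg', v', hv', hvar'⟩ := h'
  refine ⟨hg.add hg', _, hv.add hv', fun η w hw => ?_⟩
  simp only [inner_add_left, add_mul]
  rw [integral_add (MemLp.integrable_inner_two hv.memLp_grad hw.memLp_grad)
    (MemLp.integrable_inner_two hv'.memLp_grad hw.memLp_grad),
    integral_add (MemLp.integrable_mul_two hg hw.memLp) (MemLp.integrable_mul_two hg' hw.memLp),
    hvar η w hw, hvar' η w hw]
  ring

theorem IsVariationalNeumann.zero : IsVariationalNeumann Ω (fun _ => 0) (fun _ => 0) :=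
  ⟨MemLp.zero', fun _ => 0, ⟨MemLp.zero', MemLp.zero', by simp⟩, by simp⟩

/-- The Neumann Laplacian is symmetric on variational solutions. -/
theorem IsVariationalNeumann.integral_mul_comm {φ g φ' g' : E d → ℝ}
    (h : IsVariationalNeumann Ω φ g) (h' : IsVariationalNeumann Ω φ' g') :
    ∫ x in Ω, φ x * g' x = ∫ x in Ω, g x * φ' x := by
  obtain ⟨hg, v, hv, hvar⟩ := h
  obtain ⟨hg', v', hv', hvar'⟩ := h'
  have e1 := hvar φ' v' hv'
  have e2 := hvar' φ v hv
  simp only [real_inner_comm] at e1 e2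
  simp only [mul_comm (φ _)]
  linarith

/-- The weakly differentiable pairs `(u, c⁻¹ ∇u)` form the orthogonal complement of these. -/
noncomputable def testSpan (Ω : Set (E d)) (c : ℝ) :
    Submodule ℝ (WithLp 2 (Lp ℝ 2 (volume.restrict Ω) × Lp (E d) 2 (volume.restrict Ω))) :=
  Submodule.span ℝ {s | ∃ (ζ : E d → ℝ) (e : E d), ContDiff ℝ (⊤ : ℕ∞) ζ ∧ HasCompactSupport ζ ∧
    tsupport ζ ⊆ Ω ∧ s.fst =ᵐ[volume.restrict Ω] (fun x => fderiv ℝ ζ x e) ∧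
      s.snd =ᵐ[volume.restrict Ω] fun x => (c * ζ x) • e}

/-- Orthogonality to a generating pair is exactly the weak gradient identity. Thus `H¹(Ω)` appears
as an orthogonal complement, hence a closed subspace onto which one can project. -/
theorem mem_testSpan_orthogonal {c : ℝ}
    {w : WithLp 2 (Lp ℝ 2 (volume.restrict Ω) × Lp (E d) 2 (volume.restrict Ω))} :
    w ∈ (testSpan Ω c)ᗮ ↔ IsH1 Ω w.fst (fun x => c • w.snd x) := by
  have hin : ∀ (s : WithLp 2 (Lp ℝ 2 (volume.restrict Ω) × Lp (E d) 2 (volume.restrict Ω)))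
      (ζ : E d → ℝ) (e : E d), s.fst =ᵐ[volume.restrict Ω] (fun x => fderiv ℝ ζ x e) →
      s.snd =ᵐ[volume.restrict Ω] (fun x => (c * ζ x) • e) →
      inner ℝ s w = (∫ x in Ω, w.fst x * fderiv ℝ ζ x e) +
        ∫ x in Ω, ζ x * inner ℝ (c • w.snd x) e := by
    intro s ζ e h1 h2
    rw [WithLp.prod_inner_apply, L2.inner_def, L2.inner_def]
    congr 1
    · refine integral_congr_ae (h1.mono fun x hx => ?_)
      have hx' : (s.ofLp.1 : E d → ℝ) x = fderiv ℝ ζ x e := hx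
      dsimp only
      rw [hx']
      simp
    · refine integral_congr_ae (h2.mono fun x hx => ?_)
      have hx' : (s.ofLp.2 : E d → E d) x = (c * ζ x) • e := hx
      dsimp only
      rw [hx', real_inner_smul_left, real_inner_smul_left, real_inner_comm]
      change _ = ζ x * (c * inner ℝ ((w.ofLp.2 : E d → E d) x) e)
      ring
  constructor
  · intro hw
    refine ⟨Lp.memLp _, (Lp.memLp w.snd).const_smul c, fun ζ h1 h2 h3 e => ?_⟩
    have m1 : MemLp (fun x => fderiv ℝ ζ x e) 2 (volume.restrict Ω) := memLp_fderiv_test h1 h2 e 2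
    have m2 : MemLp (fun x => (c * ζ x) • e) 2 (volume.restrict Ω) :=
      (((continuous_const.mul h1.continuous).smul continuous_const).memLp_of_hasCompactSupport
        (HasCompactSupport.smul_right h2.mul_left)).restrict Ω
    have h4 := (Submodule.mem_orthogonal _ _).1 hw (WithLp.toLp 2 (m1.toLp, m2.toLp))
      (Submodule.subset_span ⟨ζ, e, h1, h2, h3, m1.coeFn_toLp, m2.coeFn_toLp⟩)
    rw [hin (WithLp.toLp 2 (m1.toLp, m2.toLp)) ζ e m1.coeFn_toLp m2.coeFn_toLp] at h4
    linarith
  · intro hw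
    rw [Submodule.mem_orthogonal]
    intro s hs
    induction hs using Submodule.span_induction with
    | mem s hs =>
      obtain ⟨ζ, e, h1, h2, h3, h4, h5⟩ := hs
      rw [hin s ζ e h4 h5, hw.weak_grad ζ h1 h2 h3 e]
      ring
    | zero => simp
    | add a b _ _ ha hb => rw [inner_add_left, ha, hb, add_zero]
    | smul t a _ ha => rw [inner_smul_left, ha, mul_zero]

theorem exists_add_mem_orthogonal {H : Type*} [NormedAddCommGroup H] [InnerProductSpace ℝ H]
    [CompleteSpace H] (K : Submodule ℝ H) (v : H) : ∃ y ∈ Kᗮ, ∃ z ∈ Kᗮᗮ, v = y + z :=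
  Submodule.exists_add_mem_mem_orthogonal v

/-- Solvability of `u - l Δu = G`, `∂ₙu = 0`. -/
theorem exists_isVariationalNeumann {G : E d → ℝ} (hG : MemLp G 2 (volume.restrict Ω)) {l : ℝ}
    (hl : 0 < l) : ∃ u : E d → ℝ, IsVariationalNeumann Ω u (fun x => (u x - G x) / l) := by
  -- With `c = l^{-1/2}` the norm of the pair `(u, c⁻¹ ∇u)` is the energy norm: its square is `‖u‖²
  -- + l ‖∇u‖²`.
  set c : ℝ := (Real.sqrt l)⁻¹ with hc
  have hs : 0 < Real.sqrt l := Real.sqrt_pos.2 hl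
  have hc0 : 0 < c := inv_pos.2 hs
  have hcl : l * (c * c) = 1 := by
    rw [hc, ← mul_inv, Real.mul_self_sqrt hl.le, mul_inv_cancel₀ hl.ne']
  -- The solution is the projection of `(G, 0)` onto `H¹`; orthogonality of the residual `z` to
  -- every `(η, c⁻¹ ∇η)` is the variational equation.
  obtain ⟨y, hy, z, hz, hyz⟩ := exists_add_mem_orthogonal (testSpan Ω c)
    (WithLp.toLp 2 (hG.toLp, (0 : Lp (E d) 2 (volume.restrict Ω))))
  have hyH := mem_testSpan_orthogonal.1 hy
  refine ⟨y.fst, ((Lp.memLp y.fst).sub hG).mul_const l⁻¹ |>.ae_eq (by rfl), _, hyH, ?_⟩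
  intro η w hw
  have hw' : MemLp (fun x => c⁻¹ • w x) 2 (volume.restrict Ω) := hw.memLp_grad.const_smul c⁻¹
  have hmem : (WithLp.toLp 2 (hw.memLp.toLp, hw'.toLp) :
      WithLp 2 (Lp ℝ 2 (volume.restrict Ω) × Lp (E d) 2 (volume.restrict Ω))) ∈
        (testSpan Ω c)ᗮ := by
    rw [mem_testSpan_orthogonal]
    refine hw.congr hw.memLp.coeFn_toLp.symm ?_
    filter_upwards [hw'.coeFn_toLp] with x hx
    change w x = c • (hw'.toLp : E d → E d) x
    rw [hx, smul_smul, mul_inv_cancel₀ hc0.ne', one_smul]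
  have h0 := (Submodule.mem_orthogonal _ _).1 hz _ hmem
  have hz' : z = WithLp.toLp 2 (hG.toLp, (0 : Lp (E d) 2 (volume.restrict Ω))) - y := by
    rw [hyz]; abel
  rw [hz', WithLp.prod_inner_apply, L2.inner_def, L2.inner_def] at h0
  have i1 : ∫ x in Ω, inner ℝ ((hw.memLp.toLp : E d → ℝ) x)
      (((hG.toLp - y.fst : Lp ℝ 2 (volume.restrict Ω)) : E d → ℝ) x) =
      ∫ x in Ω, -l * ((y.fst x - G x) / l * η x) := by
    refine integral_congr_ae ?_
    filter_upwards [hw.memLp.coeFn_toLp, hG.coeFn_toLp, Lp.coeFn_sub hG.toLp y.fst] with x a1 a2 a3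
    rw [a1, a3, Pi.sub_apply, a2]
    simp
    field_simp
    ring
  have i2 : ∫ x in Ω, inner ℝ ((hw'.toLp : E d → E d) x)
      (((0 - y.snd : Lp (E d) 2 (volume.restrict Ω)) : E d → E d) x) =
      ∫ x in Ω, -l * inner ℝ (c • y.snd x) (w x) := by
    refine integral_congr_ae ?_
    filter_upwards [hw'.coeFn_toLp, Lp.coeFn_neg y.snd] with x a1 a3
    rw [a1, zero_sub, a3, Pi.neg_apply, inner_neg_right, real_inner_smul_left,
      real_inner_smul_left, real_inner_comm]
    have : c⁻¹ = l * c := by field_simp; linarith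
    rw [this]; ring
  have h1 : (∫ x in Ω, -l * ((y.fst x - G x) / l * η x)) +
      ∫ x in Ω, -l * inner ℝ (c • y.snd x) (w x) = 0 := by
    rw [← i1, ← i2]; exact h0
  rw [integral_const_mul, integral_const_mul, ← mul_add] at h1
  have := (mul_eq_zero.1 h1).resolve_left (by linarith)
  linarith

theorem expNegInvGlue_le_one (x : ℝ) : expNegInvGlue x ≤ 1 := by
  rcases le_or_gt x 0 with h | h
  · simp [expNegInvGlue.zero_of_nonpos h]
  · simp only [expNegInvGlue, not_le.2 h, if_false]
    exact Real.exp_le_one_iff.2 (by simp [h.le])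

/-- For `x > 0` put `y = 1/x`: the derivative is `y² e^{-y}`, at most `2` since `y²/2 ≤ e^y`. For `x
≤ 0` the point is a minimum. -/
theorem deriv_expNegInvGlue_mem (x : ℝ) : deriv expNegInvGlue x ∈ Set.Icc (0 : ℝ) 2 := by
  rcases le_or_gt x 0 with h | h
  · have : IsLocalMin expNegInvGlue x := Filter.Eventually.of_forall fun y => by
      rw [expNegInvGlue.zero_of_nonpos h]; exact expNegInvGlue.nonneg y
    rw [this.deriv_eq_zero]; simp
  · have he : expNegInvGlue =ᶠ[nhds x] fun y => Real.exp (-y⁻¹) := by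
      filter_upwards [lt_mem_nhds h] with y hy
      simp [expNegInvGlue, not_le.2 hy]
    have hd : HasDerivAt (fun y : ℝ => Real.exp (-y⁻¹)) (Real.exp (-x⁻¹) * (-(-(x ^ 2)⁻¹))) x :=
      ((hasDerivAt_inv h.ne').neg).exp
    rw [he.deriv_eq, hd.deriv, neg_neg, ← inv_pow]
    have hx : 0 < x⁻¹ := inv_pos.2 h
    set y := x⁻¹
    refine ⟨by positivity, ?_⟩
    have := Real.quadratic_le_exp_of_nonneg hx.le
    rw [Real.exp_neg, ← div_eq_inv_mul, div_le_iff₀ (Real.exp_pos _)]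
    nlinarith

/-- The maximum principle for `u - l Δu = G`, `∂ₙu = 0`. -/
theorem IsVariationalNeumann.le_of_le (hΩ : IsOpen Ω) [IsFiniteMeasure (volume.restrict Ω)]
    {u g : E d → ℝ} (h : IsVariationalNeumann Ω u g) {l M : ℝ} (hl : 0 < l)
    (hM : ∀ᵐ x ∂(volume.restrict Ω), u x - l * g x ≤ M) :
    ∀ᵐ x ∂(volume.restrict Ω), u x ≤ M := by
  obtain ⟨hg, v, hv, hvar⟩ := h
  -- A smooth bounded nondecreasing replacement for `(s - M)⁺`. Testing with `f(u)` gives `∫ g f(u)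
  -- = -∫ f'(u) |∇u|² ≤ 0`, whereas `l g ≥ u - M > 0` wherever `f(u) > 0`.
  set f : ℝ → ℝ := fun s => expNegInvGlue (s - M) with hf
  have hfc : ContDiff ℝ 1 f := expNegInvGlue.contDiff.comp (contDiff_id.sub contDiff_const)
  have hfd : ∀ s, deriv f s ∈ Set.Icc (0 : ℝ) 2 := fun s => by
    rw [hf, deriv_comp_sub_const]; exact deriv_expNegInvGlue_mem _
  have hfb : ∀ s, |f s| ≤ 2 := fun s => by
    rw [hf, abs_of_nonneg (expNegInvGlue.nonneg _)]
    linarith [expNegInvGlue_le_one (s - M)]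
  have hcomp := hv.comp hΩ hfc hfb fun s => by
    rw [abs_of_nonneg (hfd s).1]; exact (hfd s).2
  have h1 := hvar _ _ hcomp
  have h2 : 0 ≤ ∫ x in Ω, inner ℝ (v x) (deriv f (u x) • v x) := by
    refine integral_nonneg fun x => ?_
    dsimp only
    rw [real_inner_smul_right]
    exact mul_nonneg (hfd _).1 real_inner_self_nonneg
  have h3 : 0 ≤ᵐ[volume.restrict Ω] fun x => g x * f (u x) := by
    filter_upwards [hM] with x hx
    rcases le_or_gt (u x) M with h4 | h4
    · simp [hf, expNegInvGlue.zero_of_nonpos (sub_nonpos.2 h4)]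
    · have : 0 < g x := by nlinarith
      exact mul_nonneg this.le (expNegInvGlue.nonneg _)
  have h4 : ∫ x in Ω, g x * f (u x) = 0 :=
    le_antisymm (by linarith) (integral_nonneg_of_ae h3)
  rw [integral_eq_zero_iff_of_nonneg_ae h3 (MemLp.integrable_mul_two hg hcomp.memLp)] at h4
  filter_upwards [h4, hM] with x hx hx'
  by_contra! hcon
  have hg0 : 0 < g x := by nlinarith
  have hf0 : 0 < f (u x) := expNegInvGlue.pos_of_pos (sub_pos.2 hcon)
  exact (mul_pos hg0 hf0).ne' hx

theorem IsVariationalNeumann.abs_le_of_abs_le (hΩ : IsOpen Ω)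
    [IsFiniteMeasure (volume.restrict Ω)]
    {u g : E d → ℝ} (h : IsVariationalNeumann Ω u g) {l M : ℝ} (hl : 0 < l)
    (hM : ∀ᵐ x ∂(volume.restrict Ω), |u x - l * g x| ≤ M) :
    ∀ᵐ x ∂(volume.restrict Ω), |u x| ≤ M := by
  have h1 := h.le_of_le hΩ hl (hM.mono fun x hx => (abs_le.1 hx).2)
  have h2 := (h.const_mul (-1)).le_of_le hΩ hl (M := M)
    (hM.mono fun x hx => by linarith [(abs_le.1 hx).1])
  filter_upwards [h1, h2] with x a b
  exact abs_le.2 ⟨by linarith, a⟩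

/-- Bounded data give bounded solutions. -/
theorem exists_isVariationalNeumann_bounded (hΩ : IsOpen Ω) [IsFiniteMeasure (volume.restrict Ω)]
    {G : E d → ℝ} (hG : MemLp G ⊤ (volume.restrict Ω)) {l : ℝ} (hl : 0 < l) :
    ∃ u : E d → ℝ, IsVariationalNeumann Ω u (fun x => (u x - G x) / l) ∧
      MemLp u ⊤ (volume.restrict Ω) := by
  obtain ⟨u, hu⟩ := exists_isVariationalNeumann (hG.mono_exponent le_top) hl
  refine ⟨u, hu, memLp_top_of_bound hu.memLp.1 (eLpNorm G ⊤ (volume.restrict Ω)).toReal ?_⟩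
  refine hu.abs_le_of_abs_le hΩ hl ?_
  filter_upwards [ae_le_eLpNormEssSup (f := G) (μ := volume.restrict Ω)] with x hx
  have e : u x - l * ((u x - G x) / l) = G x := by field_simp; ring
  rw [e, ← Real.norm_eq_abs, ← toReal_enorm]
  refine ENNReal.toReal_mono hG.2.ne ?_
  rwa [eLpNorm_exponent_top]

end Resolvent

/-! ### Bounded solutions of the scheme and the time-reversal identity -/

section BoundedSolution

variable {d : ℕ} {Ω : Set (E d)}

/-- Bounded variational solutions of the scheme. -/
structure IsBoundedSolution (Ω : Set (E d)) (m τ : ℝ) (N : ℕ) (F Ψ H : ℕ → E d → ℝ) : Prop where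
  final : ∀ᵐ x ∂(volume.restrict Ω), Ψ N x = 0
  neumann : ∀ k < N, IsVariationalNeumann Ω (Ψ k) (H k)
  memLp : ∀ k ≤ N, MemLp (Ψ k) ⊤ (volume.restrict Ω)
  memLp_laplacian : ∀ k < N, MemLp (H k) ⊤ (volume.restrict Ω)
  equation : ∀ k < N, ∀ᵐ x ∂(volume.restrict Ω),
    (Ψ (k + 1) x - Ψ k x) / τ + m * H k x = F (k + 1) x

variable {m τ : ℝ}

theorem exists_isBoundedSolution (hΩ : IsOpen Ω) [IsFiniteMeasure (volume.restrict Ω)]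
    (hm : 0 < m) (hτ : 0 < τ) (N : ℕ) (F : ℕ → E d → ℝ)
    (hF : ∀ k < N, MemLp (F (k + 1)) ⊤ (volume.restrict Ω)) :
    ∃ Ψ H : ℕ → E d → ℝ, IsBoundedSolution Ω m τ N F Ψ H := by
  induction N generalizing F with
  | zero =>
    refine ⟨fun _ _ => 0, fun _ _ => 0, ⟨by simp, by simp, fun _ _ => MemLp.zero', by simp, by simp⟩⟩
  | succ N ih =>
    -- The scheme runs backwards, so the last `N` steps are solved first with shifted data. The
    -- remaining first step is `Ψ⁰ - τ m ΔΨ⁰ = Ψ¹ - τ F¹`, a resolvent equation with `l = τ m`.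
    obtain ⟨Ψ, H, h⟩ := ih (fun k => F (k + 1)) fun k hk => hF (k + 1) (by omega)
    have hG : MemLp (fun x => Ψ 0 x - τ * F 1 x) ⊤ (volume.restrict Ω) :=
      (h.memLp 0 (Nat.zero_le _)).sub ((hF 0 (Nat.succ_pos _)).const_mul τ)
    obtain ⟨u, hu, hub⟩ := exists_isVariationalNeumann_bounded hΩ hG (mul_pos hτ hm)
    refine ⟨fun k => Nat.casesOn k u Ψ,
      fun k => Nat.casesOn k (fun x => (u x - (Ψ 0 x - τ * F 1 x)) / (τ * m)) H, ⟨?_, ?_, ?_, ?_, ?_⟩⟩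
    · exact h.final
    · rintro (_ | k) hk
      · exact hu
      · exact h.neumann k (by omega)
    · rintro (_ | k) hk
      · exact hub
      · exact h.memLp k (by omega)
    · rintro (_ | k) hk
      · have := (hub.sub hG).mul_const (τ * m)⁻¹
        exact this
      · exact h.memLp_laplacian k (by omega)
    · rintro (_ | k) hk
      · refine Filter.Eventually.of_forall fun x => ?_
        change (Ψ 0 x - u x) / τ + m * ((u x - (Ψ 0 x - τ * F 1 x)) / (τ * m)) = F 1 x
        field_simp
        ring
      · exact h.equation k (by omega)

variable {N : ℕ} {F F' Ψ Ψ' H H' : ℕ → E d → ℝ}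

theorem IsBoundedSolution.add (h : IsBoundedSolution Ω m τ N F Ψ H)
    (h' : IsBoundedSolution Ω m τ N F' Ψ' H') :
    IsBoundedSolution Ω m τ N (fun k x => F k x + F' k x) (fun k x => Ψ k x + Ψ' k x)
      (fun k x => H k x + H' k x) where
  final := by filter_upwards [h.final, h'.final] with x a b; rw [a, b, add_zero]
  neumann k hk := (h.neumann k hk).add (h'.neumann k hk)
  memLp k hk := (h.memLp k hk).add (h'.memLp k hk)
  memLp_laplacian k hk := (h.memLp_laplacian k hk).add (h'.memLp_laplacian k hk)
  equation k hk := by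
    filter_upwards [h.equation k hk, h'.equation k hk] with x a b; rw [← a, ← b]; ring

theorem IsBoundedSolution.const_mul (h : IsBoundedSolution Ω m τ N F Ψ H) (c : ℝ) :
    IsBoundedSolution Ω m τ N (fun k x => c * F k x) (fun k x => c * Ψ k x)
      (fun k x => c * H k x) where
  final := by filter_upwards [h.final] with x a; rw [a, mul_zero]
  neumann k hk := (h.neumann k hk).const_mul c
  memLp k hk := (h.memLp k hk).const_mul c
  memLp_laplacian k hk := (h.memLp_laplacian k hk).const_mul c
  equation k hk := by
    filter_upwards [h.equation k hk] with x a; rw [← a]; ring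

/-- The maximum principle with bound `0` propagates `Ψᴺ = 0` backwards through the steps. By
linearity this yields uniqueness among bounded solutions, the only uniqueness the argument uses. -/
theorem IsBoundedSolution.laplacian_eq_zero (hΩ : IsOpen Ω) [IsFiniteMeasure (volume.restrict Ω)]
    (hm : 0 < m) (hτ : 0 < τ) (h : IsBoundedSolution Ω m τ N F Ψ H)
    (hF : ∀ k < N, ∀ᵐ x ∂(volume.restrict Ω), F (k + 1) x = 0) :
    ∀ k < N, ∀ᵐ x ∂(volume.restrict Ω), H k x = 0 := by
  have key : ∀ k < N, (∀ᵐ x ∂(volume.restrict Ω), Ψ (k + 1) x = 0) →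
      (∀ᵐ x ∂(volume.restrict Ω), Ψ k x = 0) ∧ ∀ᵐ x ∂(volume.restrict Ω), H k x = 0 := by
    intro k hk h1
    have h2 : ∀ᵐ x ∂(volume.restrict Ω), Ψ k x - τ * m * H k x = 0 := by
      filter_upwards [h1, h.equation k hk, hF k hk] with x a b c
      rw [a, c] at b
      field_simp at b
      linarith
    have h3 := (h.neumann k hk).abs_le_of_abs_le hΩ (mul_pos hτ hm) (M := 0)
      (h2.mono fun x hx => by rw [hx, abs_zero])
    have h4 : ∀ᵐ x ∂(volume.restrict Ω), Ψ k x = 0 :=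
      h3.mono fun x hx => abs_eq_zero.1 (le_antisymm hx (abs_nonneg _))
    refine ⟨h4, ?_⟩
    filter_upwards [h2, h4] with x a b
    rw [b, zero_sub, neg_eq_zero] at a
    exact (mul_eq_zero.1 a).resolve_left (mul_pos hτ hm).ne'
  have hz : ∀ j ≤ N, ∀ᵐ x ∂(volume.restrict Ω), Ψ (N - j) x = 0 := by
    intro j
    induction j with
    | zero => intro _; exact h.final
    | succ j ih =>
      intro hj
      refine (key (N - (j + 1)) (by omega) ?_).1
      have := ih (by omega)
      rwa [show N - (j + 1) + 1 = N - j by omega]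
  intro k hk
  refine (key k hk ?_).2
  have := hz (N - (k + 1)) (by omega)
  rwa [show N - (N - (k + 1)) = k + 1 by omega] at this

theorem IsBoundedSolution.laplacian_unique (hΩ : IsOpen Ω) [IsFiniteMeasure (volume.restrict Ω)]
    (hm : 0 < m) (hτ : 0 < τ) (h : IsBoundedSolution Ω m τ N F Ψ H)
    (h' : IsBoundedSolution Ω m τ N F' Ψ' H')
    (hF : ∀ k < N, ∀ᵐ x ∂(volume.restrict Ω), F (k + 1) x = F' (k + 1) x) :
    ∀ k < N, ∀ᵐ x ∂(volume.restrict Ω), H k x = H' k x := by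
  intro k hk
  have := (h.add (h'.const_mul (-1))).laplacian_eq_zero hΩ hm hτ
    (fun k hk => (hF k hk).mono fun x hx => by rw [hx]; ring) k hk
  exact this.mono fun x hx => by linarith

/-- Finite measure puts bounded functions in every `Lᵖ`, and the transposition identity is the
symmetry of the variational Neumann Laplacian. -/
theorem IsBoundedSolution.isSchemeSolution [IsFiniteMeasure (volume.restrict Ω)]
    (h : IsBoundedSolution Ω m τ N F Ψ H) (p : ℝ) : IsSchemeSolution Ω m p τ N F Ψ H where
  final := h.final
  neumann k hk :=
    { memLp := (h.memLp k hk.le).mono_exponent le_top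
      memLp_laplacian := (h.memLp_laplacian k hk).mono_exponent le_top
      transposition := fun _ _ hφ _ _ => (h.neumann k hk).integral_mul_comm hφ }
  equation := h.equation

/-- The transpose of the solution map of the scheme is its time reversal. -/
theorem IsSchemeSolution.sum_integral_eq [IsFiniteMeasure (volume.restrict Ω)] {p : ℝ} (hp : 1 ≤ p)
    {G Φ L : ℕ → E d → ℝ} (h : IsSchemeSolution Ω m p τ N F Ψ H)
    (h' : IsBoundedSolution Ω m τ N G Φ L) :
    ∑ k ∈ Finset.range N, ∫ x in Ω, H k x * G (N - 1 - k + 1) x =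
      ∑ k ∈ Finset.range N, ∫ x in Ω, F (k + 1) x * L (N - 1 - k) x := by
  have hi : ∀ {f g : E d → ℝ}, MemLp f (ENNReal.ofReal p) (volume.restrict Ω) →
      MemLp g ⊤ (volume.restrict Ω) → Integrable (fun x => f x * g x) (volume.restrict Ω) :=
    fun hf hg => (memLp_one_iff_integrable.1
      (hf.mono_exponent (by simpa using hp))).mul_of_top_left hg
  have hΨ : ∀ k ≤ N, MemLp (Ψ k) (ENNReal.ofReal p) (volume.restrict Ω) := by
    intro k hk
    rcases hk.lt_or_eq with hk | rfl
    · exact (h.neumann k hk).memLp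
    · exact (MemLp.zero' (ε := ℝ)).ae_eq (h.final.mono fun x hx => hx.symm)
  have hH : ∀ k < N, MemLp (H k) (ENNReal.ofReal p) (volume.restrict Ω) :=
    fun k hk => (h.neumann k hk).memLp_laplacian
  set a : ℕ → ℕ → ℝ := fun k j => ∫ x in Ω, H k x * Φ j x with ha
  set b : ℕ → ℕ → ℝ := fun k j => ∫ x in Ω, Ψ k x * L j x with hb
  -- Transposition is available only below `N`: neither `Ψᴺ` nor `Φᴺ` comes with a Laplacian.
  have hab : ∀ k < N, ∀ j < N, a k j = b k j := fun k hk j hj =>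
    ((h.neumann k hk).transposition _ _ (h'.neumann j hj) (h'.memLp j hj.le)
      (h'.memLp_laplacian j hj)).symm
  have e1 : ∀ k < N, ∫ x in Ω, H k x * G (N - 1 - k + 1) x =
      (a k (N - 1 - k + 1) - a k (N - 1 - k)) / τ + m * ∫ x in Ω, H k x * L (N - 1 - k) x := by
    intro k hk
    have i1 := hi (hH k hk) (h'.memLp (N - 1 - k + 1) (by omega))
    have i2 := hi (hH k hk) (h'.memLp (N - 1 - k) (by omega))
    have i3 := hi (hH k hk) (h'.memLp_laplacian (N - 1 - k) (by omega))
    have i12 : Integrable (fun x => (H k x * Φ (N - 1 - k + 1) x - H k x * Φ (N - 1 - k) x) / τ)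
      (volume.restrict Ω) := (i1.sub i2).div_const τ
    simp only [ha]
    rw [← integral_sub i1 i2, ← integral_div, ← integral_const_mul,
      ← integral_add i12 (i3.const_mul m)]
    refine integral_congr_ae ((h'.equation (N - 1 - k) (by omega)).mono fun x hx => ?_)
    dsimp only
    rw [← hx]; ring
  have e2 : ∀ k < N, ∫ x in Ω, F (k + 1) x * L (N - 1 - k) x =
      (b (k + 1) (N - 1 - k) - b k (N - 1 - k)) / τ + m * ∫ x in Ω, H k x * L (N - 1 - k) x := by
    intro k hk
    have hL := h'.memLp_laplacian (N - 1 - k) (by omega)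
    have i1 := hi (hΨ (k + 1) (by omega)) hL
    have i2 := hi (hΨ k hk.le) hL
    have i3 := hi (hH k hk) hL
    have i12 : Integrable (fun x => (Ψ (k + 1) x * L (N - 1 - k) x - Ψ k x * L (N - 1 - k) x) / τ)
      (volume.restrict Ω) := (i1.sub i2).div_const τ
    simp only [hb]
    rw [← integral_sub i1 i2, ← integral_div, ← integral_const_mul,
      ← integral_add i12 (i3.const_mul m)]
    refine integral_congr_ae ((h.equation k hk).mono fun x hx => ?_)
    dsimp only
    rw [← hx]; ring
  rw [Finset.sum_congr rfl fun k hk => e1 k (Finset.mem_range.1 hk),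
    Finset.sum_congr rfl fun k hk => e2 k (Finset.mem_range.1 hk),
    Finset.sum_add_distrib, Finset.sum_add_distrib, ← Finset.sum_div, ← Finset.sum_div,
    Finset.sum_sub_distrib, Finset.sum_sub_distrib,
    Finset.sum_congr rfl fun k hk => hab k (Finset.mem_range.1 hk) (N - 1 - k)
      (by have := Finset.mem_range.1 hk; omega)]
  -- What remains compares `a k (N - k)` with `b (k + 1) (N - 1 - k)`. The unmatched end terms
  -- vanish by `Φᴺ = 0` and `Ψᴺ = 0`; after a shift of index the others agree by `hab`.
  congr 3
  rcases N with _ | n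
  · simp
  have ha0 : a 0 (n + 1) = 0 := integral_eq_zero_of_ae (h'.final.mono fun x hx => by simp [hx])
  have hb0 : b (n + 1) 0 = 0 := integral_eq_zero_of_ae (h.final.mono fun x hx => by simp [hx])
  rw [Finset.sum_range_succ', Finset.sum_range_succ]
  simp only [Nat.add_sub_cancel, Nat.sub_zero, Nat.sub_self, ha0, hb0, add_zero]
  refine Finset.sum_congr rfl fun k hk => ?_
  have := Finset.mem_range.1 hk
  rw [show n - (k + 1) + 1 = n - k by omega]
  exact hab _ (by omega) _ (by omega)

end BoundedSolution

/-! ### Discrete norms as `Lᵖ` norms over space-time -/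

section SpaceTime

variable {d : ℕ} {Ω : Set (E d)} {m τ : ℝ} {N : ℕ}

/-- The space-time measure whose `Lᵖ` norms are the discrete norms. -/
noncomputable def spaceTime (Ω : Set (E d)) (τ : ℝ) (N : ℕ) : Measure (ℕ × E d) :=
  ∑ k ∈ Finset.range N, ENNReal.ofReal τ • (volume.restrict Ω).map (Prod.mk k)

theorem lintegral_spaceTime (f : ℕ × E d → ℝ≥0∞) :
    ∫⁻ z, f z ∂(spaceTime Ω τ N) =
      ∑ k ∈ Finset.range N, ENNReal.ofReal τ * ∫⁻ x in Ω, f (k, x) := by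
  rw [spaceTime, lintegral_finsetSum_measure]
  refine Finset.sum_congr rfl fun k _ => ?_
  rw [lintegral_smul_measure, (measurableEmbedding_prodMk_left k).lintegral_map, smul_eq_mul]

theorem ae_spaceTime (hτ : 0 < τ) {P : ℕ × E d → Prop} :
    (∀ᵐ z ∂(spaceTime Ω τ N), P z) ↔ ∀ k < N, ∀ᵐ x ∂(volume.restrict Ω), P (k, x) := by
  rw [spaceTime, ae_finsetSum_measure_iff]
  simp only [Finset.mem_range]
  refine forall₂_congr fun k _ => ?_
  rw [Measure.ae_ennreal_smul_measure_iff (by simpa using hτ),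
    (measurableEmbedding_prodMk_left k).ae_map_iff]

instance [IsFiniteMeasure (volume.restrict Ω)] : IsFiniteMeasure (spaceTime Ω τ N) := by
  refine ⟨?_⟩
  rw [← lintegral_one, lintegral_spaceTime]
  simp only [lintegral_one]
  exact ENNReal.sum_lt_top.2 fun k _ => ENNReal.mul_lt_top ENNReal.ofReal_lt_top (measure_lt_top _ _)

theorem integral_spaceTime (hτ : 0 < τ) {f : ℕ × E d → ℝ} (hf : Integrable f (spaceTime Ω τ N)) :
    ∫ z, f z ∂(spaceTime Ω τ N) = τ * ∑ k ∈ Finset.range N, ∫ x in Ω, f (k, x) := by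
  rw [spaceTime, integral_finsetSum_measure, Finset.mul_sum]
  · refine Finset.sum_congr rfl fun k _ => ?_
    rw [integral_smul_measure, (measurableEmbedding_prodMk_left k).integral_map,
      ENNReal.toReal_ofReal hτ.le, smul_eq_mul]
  · exact integrable_finsetSum_measure.1 hf

theorem aestronglyMeasurable_spaceTime {u : ℕ → E d → ℝ}
    (hu : ∀ k < N, AEStronglyMeasurable (u k) (volume.restrict Ω)) :
    AEStronglyMeasurable (fun z : ℕ × E d => u z.1 z.2) (spaceTime Ω τ N) := by
  rw [spaceTime, Finset.sum_range, ← Measure.sum_fintype, aestronglyMeasurable_sum_measure_iff]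
  intro k
  refine AEStronglyMeasurable.smul_measure ?_ _
  rw [(measurableEmbedding_prodMk_left (k : ℕ)).aestronglyMeasurable_map_iff]
  exact hu k k.2

theorem discreteNorm_eq_eLpNorm {p : ℝ} (hp : 0 < p) (u : ℕ → E d → ℝ) :
    discreteNorm Ω p τ N u =
      eLpNorm (fun z : ℕ × E d => u z.1 z.2) (ENNReal.ofReal p) (spaceTime Ω τ N) := by
  rw [discreteNorm, eLpNorm_ofReal_eq hp, lintegral_spaceTime]
  simp only [lintegral_enorm_rpow_eq hp]

theorem memLp_spaceTime {p : ℝ} (hp : 0 < p) {u : ℕ → E d → ℝ}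
    (hu : ∀ k < N, MemLp (u k) (ENNReal.ofReal p) (volume.restrict Ω)) :
    MemLp (fun z : ℕ × E d => u z.1 z.2) (ENNReal.ofReal p) (spaceTime Ω τ N) := by
  refine ⟨aestronglyMeasurable_spaceTime fun k hk => (hu k hk).1, ?_⟩
  rw [← discreteNorm_eq_eLpNorm hp, discreteNorm]
  refine (ENNReal.rpow_ne_top_of_nonneg (by positivity) ?_).lt_top
  refine (ENNReal.sum_lt_top.2 fun k hk => ENNReal.mul_lt_top ENNReal.ofReal_lt_top ?_).ne
  exact (ENNReal.rpow_ne_top_of_nonneg hp.le (hu k (Finset.mem_range.1 hk)).2.ne).lt_top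

theorem memLp_top_spaceTime (hτ : 0 < τ) {u : ℕ → E d → ℝ}
    (hu : ∀ k < N, MemLp (u k) ⊤ (volume.restrict Ω)) :
    MemLp (fun z : ℕ × E d => u z.1 z.2) ⊤ (spaceTime Ω τ N) := by
  refine memLp_top_of_bound (aestronglyMeasurable_spaceTime fun k hk => (hu k hk).1)
    (∑ k ∈ Finset.range N, (eLpNorm (u k) ⊤ (volume.restrict Ω)).toReal) ?_
  rw [ae_spaceTime hτ]
  intro k hk
  filter_upwards [ae_le_eLpNormEssSup (f := u k) (μ := volume.restrict Ω)] with x hx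
  refine le_trans ?_ (Finset.single_le_sum (fun _ _ => ENNReal.toReal_nonneg)
    (Finset.mem_range.2 hk))
  rw [← toReal_enorm]
  refine ENNReal.toReal_mono (hu k hk).2.ne ?_
  rwa [eLpNorm_exponent_top]

theorem discreteNorm_reflect (p : ℝ) (u : ℕ → E d → ℝ) :
    discreteNorm Ω p τ N (fun k => u (N - 1 - k)) = discreteNorm Ω p τ N u := by
  rw [discreteNorm, discreteNorm, Finset.sum_range_reflect
    fun k => ENNReal.ofReal τ * eLpNorm (u k) (ENNReal.ofReal p) (volume.restrict Ω) ^ p]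

theorem memLp_slice [IsFiniteMeasure (volume.restrict Ω)] (f : SimpleFunc (ℕ × E d) ℝ) (k : ℕ)
    (p : ℝ≥0∞) : MemLp (fun x => f (k, x)) p (volume.restrict Ω) :=
  SimpleFunc.memLp_of_isFiniteMeasure (f.comp (Prod.mk k) measurable_prodMk_left) p _

end SpaceTime

/-! ### Admissible constants: duality, reduction to simple data, interpolation -/

section Admissible

variable {d : ℕ} {Ω : Set (E d)} {m τ : ℝ} {N : ℕ}

/-- Admissible constants for simple data and bounded solutions. -/
def IsSimpleAdmissible (Ω : Set (E d)) (m p : ℝ) (C : ℝ≥0∞) : Prop :=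
  ∀ (τ : ℝ) (N : ℕ), 0 < τ → ∀ (f : SimpleFunc (ℕ × E d) ℝ) (Ψ H : ℕ → E d → ℝ),
    IsBoundedSolution Ω m τ N (fun k x => f (k - 1, x)) Ψ H →
      eLpNorm (fun z : ℕ × E d => H z.1 z.2) (ENNReal.ofReal p) (spaceTime Ω τ N) ≤
        C * eLpNorm f (ENNReal.ofReal p) (spaceTime Ω τ N)

/-- The shift `k - 1` places the datum `Fᵏ⁺¹` on the time slice `k`, where `ΔΨᵏ` also lives. -/
theorem IsAdmissible.isSimpleAdmissible [IsFiniteMeasure (volume.restrict Ω)] {p : ℝ} (hp : 0 < p)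
    {C : ℝ≥0∞} (h : IsAdmissible Ω m p C) : IsSimpleAdmissible Ω m p C := by
  intro τ N hτ f Ψ H hS
  have := h τ N hτ _ Ψ H (fun k _ => memLp_slice f _ _) (hS.isSchemeSolution p)
  rwa [discreteNorm_eq_eLpNorm hp, discreteNorm_eq_eLpNorm hp] at this

/-- An arbitrary `L^q` solution is paired with a simple `g`. Solving the scheme for the time
reversal of `g` moves the pairing onto `F`, and Hölder's inequality with the `Lᵖ` bound for that
bounded solution concludes. -/
theorem IsSimpleAdmissible.isAdmissible_dual (hΩ : IsOpen Ω) [IsFiniteMeasure (volume.restrict Ω)]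
    (hm : 0 < m) {p q : ℝ} (hpq : p.HolderConjugate q) {C : ℝ≥0∞}
    (h : IsSimpleAdmissible Ω m p C) : IsAdmissible Ω m q C := by
  intro τ N hτ F Ψ H hF hS
  have hp := hpq.pos
  have hq := hpq.symm.pos
  rw [discreteNorm_eq_eLpNorm hq]
  have hH := memLp_spaceTime (τ := τ) hq fun k hk => (hS.neumann k hk).memLp_laplacian
  refine eLpNorm_le_of_simpleFunc hpq hH fun g => ?_
  have hrm : Measurable fun z : ℕ × E d => (N - 1 - z.1, z.2) :=
    (measurable_from_nat (f := fun k => N - 1 - k)).comp measurable_fst |>.prodMk measurable_snd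
  set g' : SimpleFunc (ℕ × E d) ℝ := g.comp _ hrm with hg'
  obtain ⟨Φ, L, hL⟩ := exists_isBoundedSolution hΩ hm hτ N (fun k x => g' (k - 1, x))
    fun k _ => memLp_slice g' _ _
  have hLm : MemLp (fun z : ℕ × E d => L (N - 1 - z.1) z.2) (ENNReal.ofReal p)
      (spaceTime Ω τ N) := memLp_spaceTime (u := fun k => L (N - 1 - k)) hp fun k hk =>
    (hL.memLp_laplacian _ (by omega)).mono_exponent le_top
  have hFm := memLp_spaceTime (τ := τ) (u := fun k => F (k + 1)) hq hF
  have e1 : ∫ z, H z.1 z.2 * g z ∂(spaceTime Ω τ N) =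
      ∫ z, F (z.1 + 1) z.2 * L (N - 1 - z.1) z.2 ∂(spaceTime Ω τ N) := by
    rw [integral_spaceTime hτ (MemLp.integrable_mul_of_holderConjugate hpq.symm hH
      (SimpleFunc.memLp_of_isFiniteMeasure g _ _)), integral_spaceTime hτ
      (MemLp.integrable_mul_of_holderConjugate hpq.symm hFm hLm)]
    congr 1
    rw [← hS.sum_integral_eq hpq.symm.lt.le hL]
    refine Finset.sum_congr rfl fun k hk => ?_
    have hk := Finset.mem_range.1 hk
    congr 1; ext x
    simp only [hg', SimpleFunc.coe_comp, Function.comp]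
    rw [show N - 1 - (N - 1 - k + 1 - 1) = k by omega]
  have e2 : eLpNorm (fun z : ℕ × E d => L (N - 1 - z.1) z.2) (ENNReal.ofReal p)
      (spaceTime Ω τ N) ≤ C * eLpNorm g (ENNReal.ofReal p) (spaceTime Ω τ N) := by
    have a1 := discreteNorm_eq_eLpNorm (Ω := Ω) (τ := τ) (N := N) hp fun k => L (N - 1 - k)
    have a2 := discreteNorm_eq_eLpNorm (Ω := Ω) (τ := τ) (N := N) hp
      fun k x => g (N - 1 - k, x)
    have a3 := discreteNorm_eq_eLpNorm (Ω := Ω) (τ := τ) (N := N) hp fun k x => g (k, x)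
    rw [discreteNorm_reflect, discreteNorm_eq_eLpNorm hp] at a1
    rw [discreteNorm_reflect p fun k x => g (k, x), a3] at a2
    rw [← a1]
    refine (h τ N hτ g' Φ L hL).trans (le_of_eq ?_)
    congr 1
    exact a2.symm
  rw [e1]
  calc _ ≤ _ := ofReal_integral_le_lintegral_enorm _
    _ ≤ _ := lintegral_enorm_mul_le hpq.symm hFm.1 hLm.1
    _ ≤ _ := mul_le_mul_right e2 _
    _ = _ := by rw [discreteNorm_eq_eLpNorm hq]; ring

/-- Duality turns a bound on simple data into one on all data at the conjugate exponent; applying it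
twice returns to `p`. This replaces approximation of `Lᵖ` solutions by bounded ones. -/
theorem isAdmissible_iff_isSimpleAdmissible (hΩ : IsOpen Ω) [IsFiniteMeasure (volume.restrict Ω)]
    (hm : 0 < m) {p : ℝ} (hp : 1 < p) {C : ℝ≥0∞} :
    IsAdmissible Ω m p C ↔ IsSimpleAdmissible Ω m p C := by
  have hpq := Real.HolderConjugate.conjExponent hp
  exact ⟨fun h => h.isSimpleAdmissible hpq.pos, fun h =>
    ((h.isAdmissible_dual hΩ hm hpq).isSimpleAdmissible hpq.symm.pos).isAdmissible_dual hΩ hm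
      hpq.symm⟩

theorem isAdmissible_iff_of_holderConjugate (hΩ : IsOpen Ω)
    [IsFiniteMeasure (volume.restrict Ω)] (hm : 0 < m) {p q : ℝ} (hpq : p.HolderConjugate q)
    {C : ℝ≥0∞} : IsAdmissible Ω m p C ↔ IsAdmissible Ω m q C :=
  ⟨fun h => (h.isSimpleAdmissible hpq.pos).isAdmissible_dual hΩ hm hpq,
    fun h => (h.isSimpleAdmissible hpq.symm.pos).isAdmissible_dual hΩ hm hpq.symm⟩

theorem IsBoundedSolution.eLpNorm_eq_zero (hΩ : IsOpen Ω) [IsFiniteMeasure (volume.restrict Ω)]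
    (hm : 0 < m) (hτ : 0 < τ) {f : SimpleFunc (ℕ × E d) ℝ} {Ψ H : ℕ → E d → ℝ}
    (h : IsBoundedSolution Ω m τ N (fun k x => f (k - 1, x)) Ψ H) {p : ℝ} (hp : 0 < p)
    (hf : eLpNorm f (ENNReal.ofReal p) (spaceTime Ω τ N) = 0) :
    eLpNorm (fun z : ℕ × E d => H z.1 z.2) (ENNReal.ofReal p) (spaceTime Ω τ N) = 0 := by
  rw [eLpNorm_eq_zero_iff f.aestronglyMeasurable (by simpa using hp)] at hf
  have h1 := (ae_spaceTime hτ).1 hf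
  have h2 := h.laplacian_eq_zero hΩ hm hτ h1
  have h3 : (fun z : ℕ × E d => H z.1 z.2) =ᵐ[spaceTime Ω τ N] 0 := (ae_spaceTime hτ).2 h2
  rw [eLpNorm_congr_ae h3, eLpNorm_zero]

/-- The infimum is itself a valid constant: divide by the finite data norm. Data of norm zero need
the uniqueness argument, since the product `∞ · 0` is `0`. -/
theorem isSimpleAdmissible_K (hΩ : IsOpen Ω) [IsFiniteMeasure (volume.restrict Ω)]
    (hm : 0 < m) {p : ℝ} (hp : 1 < p) : IsSimpleAdmissible Ω m p (K Ω m p) := by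
  intro τ N hτ f Ψ H h
  have hp0 : 0 < p := by linarith
  by_cases hf : eLpNorm f (ENNReal.ofReal p) (spaceTime Ω τ N) = 0
  · rw [h.eLpNorm_eq_zero hΩ hm hτ hp0 hf]; exact zero_le
  · have hft := simpleFunc_eLpNorm_ne_top (μ := spaceTime Ω τ N) f (ENNReal.ofReal p)
    rw [← ENNReal.div_le_iff hf hft]
    refine le_sInf fun C hC => ?_
    rw [ENNReal.div_le_iff hf hft]
    exact hC.isSimpleAdmissible hp0 τ N hτ f Ψ H h

theorem isBoundedSolution_sum (s : Finset ℝ) (c : ℝ → ℝ) {F Ψ H : ℝ → ℕ → E d → ℝ}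
    (h : ∀ a, IsBoundedSolution Ω m τ N (F a) (Ψ a) (H a)) :
    IsBoundedSolution Ω m τ N (fun k x => ∑ a ∈ s, c a * F a k x)
      (fun k x => ∑ a ∈ s, c a * Ψ a k x) (fun k x => ∑ a ∈ s, c a * H a k x) := by
  induction s using Finset.induction_on with
  | empty =>
    simp only [Finset.sum_empty]
    exact ⟨by simp, fun _ _ => IsVariationalNeumann.zero, fun _ _ => MemLp.zero',
      fun _ _ => MemLp.zero', by simp⟩
  | insert b s hb ih =>
    simp only [Finset.sum_insert hb]
    exact ((h b).const_mul (c b)).add ih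

/-- By linearity the response to `c ∘ f` is a combination of fixed responses `ψ a` to the indicators
of `{f = a}`. In this form the coefficients may be made complex. -/
theorem exists_laplacian_decomposition (hΩ : IsOpen Ω) [IsFiniteMeasure (volume.restrict Ω)]
    (hm : 0 < m) (hτ : 0 < τ) (N : ℕ) (f : SimpleFunc (ℕ × E d) ℝ) :
    ∃ ψ : ℝ → ℕ × E d → ℝ, (∀ a, MemLp (ψ a) ⊤ (spaceTime Ω τ N)) ∧ ∀ c : ℝ → ℝ,
      ∃ Ψ H : ℕ → E d → ℝ, IsBoundedSolution Ω m τ N (fun k x => f.map c (k - 1, x)) Ψ H ∧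
        (fun z : ℕ × E d => H z.1 z.2) = fun z => ∑ a ∈ f.range, c a * ψ a z := by
  choose Ψ H h using fun a : ℝ => exists_isBoundedSolution hΩ hm hτ N
    (fun k x => (f.map fun b => if b = a then (1 : ℝ) else 0) (k - 1, x))
    fun k _ => memLp_slice _ _ _
  refine ⟨fun a z => H a z.1 z.2, fun a => memLp_top_spaceTime hτ (h a).memLp_laplacian,
    fun c => ⟨fun k x => ∑ a ∈ f.range, c a * Ψ a k x, fun k x => ∑ a ∈ f.range, c a * H a k x,
      ?_, rfl⟩⟩
  have hsum : (fun (k : ℕ) (x : E d) => ∑ a ∈ f.range, c a *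
      (f.map fun b => if b = a then (1 : ℝ) else 0) (k - 1, x)) =
      fun k x => f.map c (k - 1, x) := by
    ext k x
    rw [Finset.sum_eq_single (f (k - 1, x))]
    · simp
    · intro b _ hb; simp [hb.symm]
    · intro hcon; exact (hcon (SimpleFunc.mem_range_self f _)).elim
  rw [← hsum]
  exact isBoundedSolution_sum f.range c h

theorem IsSimpleAdmissible.interpolate (hΩ : IsOpen Ω) [IsFiniteMeasure (volume.restrict Ω)]
    (hm : 0 < m) {p q r θ : ℝ} (hp : 1 < p) (hq : 1 < q) (hr : 1 < r) (hθ0 : 0 < θ) (hθ1 : θ < 1)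
    (hrθ : 1 / r = θ / p + (1 - θ) / q) {Cp Cq : ℝ≥0∞} (hCp : IsSimpleAdmissible Ω m p Cp)
    (hCq : IsSimpleAdmissible Ω m q Cq) : IsSimpleAdmissible Ω m r (Cp ^ θ * Cq ^ (1 - θ)) := by
  intro τ N hτ f Ψ H h
  have hp0 : 0 < p := by linarith
  have hq0 : 0 < q := by linarith
  have hr0 : 0 < r := by linarith
  by_cases hf : eLpNorm f (ENNReal.ofReal r) (spaceTime Ω τ N) = 0
  · rw [h.eLpNorm_eq_zero hΩ hm hτ hr0 hf]; exact zero_le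
  have hHm : MemLp (fun z : ℕ × E d => H z.1 z.2) ⊤ (spaceTime Ω τ N) :=
    memLp_top_spaceTime hτ h.memLp_laplacian
  have hzero : ∀ {s : ℝ}, 0 < s → IsSimpleAdmissible Ω m s 0 →
      eLpNorm (fun z : ℕ × E d => H z.1 z.2) (ENNReal.ofReal r) (spaceTime Ω τ N) = 0 := by
    intro s hs h0
    have h1 := h0 τ N hτ f Ψ H h
    rw [zero_mul, nonpos_iff_eq_zero, eLpNorm_eq_zero_iff hHm.1 (by simpa using hs)] at h1
    rw [eLpNorm_congr_ae h1, eLpNorm_zero]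
  -- Riesz-Thorin is applied with finite constants. A zero constant forces `H = 0`; an infinite one,
  -- the other being nonzero, makes the right side infinite because the data norm is nonzero.
  rcases eq_or_ne Cp 0 with rfl | hCp0
  · rw [hzero hp0 hCp]; exact zero_le
  rcases eq_or_ne Cq 0 with rfl | hCq0
  · rw [hzero hq0 hCq]; exact zero_le
  have hth : 0 < 1 - θ := by linarith
  rcases eq_or_ne Cp ⊤ with rfl | hCpt
  · rw [ENNReal.top_rpow_of_pos hθ0, ENNReal.top_mul, ENNReal.top_mul hf]
    · exact le_top
    · exact fun h0 => by simp [ENNReal.rpow_eq_zero_iff, hCq0, hth.not_gt] at h0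
  rcases eq_or_ne Cq ⊤ with rfl | hCqt
  · rw [ENNReal.top_rpow_of_pos hth, ENNReal.mul_top, ENNReal.top_mul hf]
    · exact le_top
    · exact fun h0 => by simp [ENNReal.rpow_eq_zero_iff, hCp0, hθ0.not_gt] at h0
  obtain ⟨ψ, hψ, hsol⟩ := exists_laplacian_decomposition hΩ hm hτ N f
  have hbound : ∀ {s : ℝ} {C : ℝ≥0∞}, IsSimpleAdmissible Ω m s C → ∀ c : ℝ → ℝ,
      eLpNorm (fun z => ∑ a ∈ f.range, c a * ψ a z) (ENNReal.ofReal s) (spaceTime Ω τ N) ≤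
        C * eLpNorm (fun z => c (f z)) (ENNReal.ofReal s) (spaceTime Ω τ N) := by
    intro s C hC c
    obtain ⟨Ψ', H', h1, h2⟩ := hsol c
    rw [← h2]
    exact hC τ N hτ (f.map c) _ _ h1
  have hRT := riesz_thorin_simpleFunc (μ := spaceTime Ω τ N)
    (Real.HolderConjugate.conjExponent hp) (Real.HolderConjugate.conjExponent hq)
    (Real.HolderConjugate.conjExponent hr) hθ0 hθ1 hrθ f hψ hCpt hCqt (hbound hCp) (hbound hCq)
  -- The coefficients `c = id` reproduce `f`, and uniqueness identifies the given solution with the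
  -- decomposed one.
  obtain ⟨Ψ', H', h1, h2⟩ := hsol id
  have h3 := h.laplacian_unique hΩ hm hτ h1 fun k _ => Filter.Eventually.of_forall fun x => rfl
  have h4 : (fun z : ℕ × E d => H z.1 z.2) =ᵐ[spaceTime Ω τ N] fun z => H' z.1 z.2 :=
    (ae_spaceTime hτ).2 h3
  rw [eLpNorm_congr_ae h4, h2]
  exact hRT

end Admissible

end DiscreteDuality

theorem mainTheorem5 {d : ℕ} (Ω : Set (DiscreteDuality.E d))
    (hΩ : DiscreteDuality.IsSmoothBoundedDomain Ω) (m : ℝ) (hm : 0 < m) :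
    (∀ p p' : ℝ, 1 < p → 1 / p + 1 / p' = 1 →
      DiscreteDuality.K Ω m p = DiscreteDuality.K Ω m p') ∧
    (∀ p q r θ : ℝ, 1 < p → 1 < q → 0 < θ → θ < 1 → 1 / r = θ / p + (1 - θ) / q →
      DiscreteDuality.K Ω m r ≤
        DiscreteDuality.K Ω m p ^ θ * DiscreteDuality.K Ω m q ^ (1 - θ)) := by
  have : IsFiniteMeasure (volume.restrict Ω) :=
    ⟨by rw [Measure.restrict_apply_univ]; exact hΩ.isBounded.measure_lt_top⟩
  refine ⟨fun p p' hp hpp => ?_, fun p q r θ hp hq hθ0 hθ1 hr => ?_⟩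
  · have hpq : p.HolderConjugate p' :=
      Real.holderConjugate_iff.2 ⟨hp, by simpa only [one_div] using hpp⟩
    unfold DiscreteDuality.K
    congr 1
    ext C
    exact DiscreteDuality.isAdmissible_iff_of_holderConjugate hΩ.isOpen hm hpq
  -- Here `1/r` is a convex combination of two numbers in `(0, 1)`.
  · have hr1 : 1 < r := by
      have h1 : θ / p < θ := div_lt_self hθ0 hp
      have h2 : (1 - θ) / q < 1 - θ := div_lt_self (by linarith) hq
      have h3 : 0 < θ / p := div_pos hθ0 (by linarith)
      have h4 : 0 < (1 - θ) / q := div_pos (by linarith) (by linarith)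
      have h5 : 1 / r < 1 := by linarith
      have h6 : 0 < r := one_div_pos.1 (by linarith)
      rwa [div_lt_one h6] at h5
    exact sInf_le ((DiscreteDuality.isAdmissible_iff_isSimpleAdmissible hΩ.isOpen hm hr1).2
      ((DiscreteDuality.isSimpleAdmissible_K hΩ.isOpen hm hp).interpolate hΩ.isOpen hm hp hq hr1
        hθ0 hθ1 hr (DiscreteDuality.isSimpleAdmissible_K hΩ.isOpen hm hq)))
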